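/- Let $\mathbb F$ be a finite field and let $\mathcal X$ be a nonsingular, geometrically irreducible, projective algebraic curve over $\mathbb F$ with function field $\mathbb F(\mathcal X)$. For a closed point $Q$ let $\mathcal O_Q\subset\mathbb F(\mathcal X)$ be its local ring and $v_Q$ its discrete valuation. Let $m\ge 1$, $n\ge 0$, let $Q_1,\dots,Q_m$ be distinct rational points and $P_1,\dots,P_n$ distinct rational points of $\mathcal X$ with $P_i\ne Q_k$ for all $i,k$. Let $\boldsymbol a=(a_1,\dots,a_m)\in\mathbb N_0^m$, $G=\sum_k a_kQ_k$, $D=P_1+\cdots+P_n$. Put $L(G)=\{h\in\mathbb F(\mathcal X)^*: \mathrm{div}(h)+G\ge 0\}\cup\{0\}$ and $C_{\mathcal L}(D,G)=\{(h(P_1),\dots,h(P_n)) : h\in L(G)\}$. Let $$\mathbf R=\bigcap_{Q\ne Q_1,\dots,Q_m}\mathcal O_Q,\qquad \varphi:\mathbf R\to\mathbb F^n,\quad \varphi(f)=(f(P_1),\dots,f(P_n)),$$ and for $k=1,\dots,m$ define $\rho_k:\mathbf R\to\mathbb N_0\cup\{-\infty\}$ by $\rho_k(0)=-\infty$ and $\rho_k(f)=\max\{0,-v_{Q_k}(f)\}$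 for $f\ne 0$. Terminology. For a function $\rho:\mathbf R\to\mathbb N_0\cup\{-\infty\}$ let $\mathcal U_\rho=\{f:\rho(f)\le\rho(1)\}$ and $\mathcal M_\rho=\{f:\rho(f)>\rho(1)\}$. Then $\rho$ is a *near weight* if for all $f,g,h\in\mathbf R$: (N0) $\rho(f)=-\infty\Leftrightarrow f=0$; (N1) $\rho(\lambda f)=\rho(f)$ for $\lambda\in\mathbb F^*$; (N2) $\rho(f+g)\le\max\{\rho(f),\rho(g)\}$; (N3) if $\rho(f)<\rho(g)$ then $\rho(fh)\le\rho(gh)$, with strict inequality if $h\in\mathcal M_\rho$; (N4) if $\rho(f)=\rho(g)$ and $f,g\in\mathcal M_\rho$ then $\rho(f-\lambda g)<\rho(f)$ for some $\lambda\in\mathbb F^*$; (N5) $\rho(fg)\le\rho(f)+\rho(g)$, with equality if $f,g\in\mathcal M_\rho$. It is *nontrivial* if $\mathcal M_\rho\neq\emptyset$, and *normalized* if $\rho(f)=0$ for all $f\in\mathcal U_\rho\setminus\{0\}$. Nontrivial, normalized near weights $\rho_1,\dots,\rho_m$ form a *complete set* for $\mathbf R$ if $\bigcap_{i}\mathcal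 U_{\rho_i}=\mathbb F$ and, for every $k$, the set $\mathbb N_0\setminus\rho_k\big(\bigcap_{i\ne k}\mathcal U_{\rho_i}\big)$ is finite (for $m=1$ the empty intersection is $\mathbf R$). For such a set, and a surjective morphism $\varphi:\mathbf R\to\mathbb F^n$ of $\mathbb F$-algebras, one puts $C(\boldsymbol a)=\varphi(\{f\in\mathbf R:\rho_i(f)\le a_i\text{ for all } i\})$. Then $\rho_1,\dots,\rho_m$ form a complete set of near weights for $\mathbf R$, the map $\varphi$ is a surjective morphism of $\mathbb F$-algebras, and $C_{\mathcal L}(D,G)=C(\boldsymbol a)$. -/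

import Mathlib

open AlgebraicGeometry CategoryTheory

universe u

/-! ### Near weights on an algebra -/

section NearWeights

variable {F R : Type*} [Field F] [CommRing R] [Algebra F R]

/-- `𝒰_ρ = {f | ρ f ≤ ρ 1}`. The value `-∞` is `⊥ : WithBot ℕ`. -/
def NearU (ρ : R → WithBot ℕ) : Set R := {f | ρ f ≤ ρ 1}

/-- `ℳ_ρ = {f | ρ f > ρ 1}`. -/
def NearM (ρ : R → WithBot ℕ) : Set R := {f | ρ 1 < ρ f}

/-- Near order functions `ρ : R → ℕ ∪ {-∞}` on an `F`-algebra `R`. -/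
structure IsNearOrder (F : Type*) {R : Type*} [Field F] [CommRing R] [Algebra F R]
    (ρ : R → WithBot ℕ) : Prop where
  eq_bot_iff : ∀ f, ρ f = ⊥ ↔ f = 0
  smul : ∀ (c : F) (f : R), c ≠ 0 → ρ (c • f) = ρ f
  add_le : ∀ f g, ρ (f + g) ≤ max (ρ f) (ρ g)
  mul_le_mul : ∀ f g h, ρ f < ρ g → ρ (f * h) ≤ ρ (g * h)
  mul_lt_mul : ∀ f g h, ρ f < ρ g → h ∈ NearM ρ → ρ (f * h) < ρ (g * h)
  exists_sub_lt : ∀ f g, ρ f = ρ g → f ∈ NearM ρ → g ∈ NearM ρ →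
    ∃ c : F, c ≠ 0 ∧ ρ (f - c • g) < ρ f

/-- Near weights: near orders that are subadditive for products, and additive on `ℳ_ρ`. -/
structure IsNearWeight (F : Type*) {R : Type*} [Field F] [CommRing R] [Algebra F R]
    (ρ : R → WithBot ℕ) : Prop extends IsNearOrder F ρ where
  mul_le : ∀ f g, ρ (f * g) ≤ ρ f + ρ g
  mul_eq : ∀ f g, f ∈ NearM ρ → g ∈ NearM ρ → ρ (f * g) = ρ f + ρ g

/-- A function `ρ` is normalized if it is equal to its normalization, i.e. it takes the value `0`
at the nonzero elements of `𝒰_ρ` (and `-∞` at `0`). -/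
def IsNormalizedNear (ρ : R → WithBot ℕ) : Prop :=
  ρ 0 = ⊥ ∧ ∀ f ∈ NearU ρ, f ≠ 0 → ρ f = 0

/-- A complete set `ρ₁, …, ρₘ` of (nontrivial, normalized) near weights for `R`. -/
structure IsCompleteSetOfNearWeights (F : Type*) {R : Type*} [Field F] [CommRing R] [Algebra F R]
    {m : ℕ} (ρ : Fin m → R → WithBot ℕ) : Prop where
  nearWeight : ∀ k, IsNearWeight F (ρ k)
  nontrivial : ∀ k, (NearM (ρ k)).Nonempty
  normalized : ∀ k, IsNormalizedNear (ρ k)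
  /-- `⋂ᵢ 𝒰_{ρᵢ} = F`. -/
  iInter_eq : ⋂ i, NearU (ρ i) = Set.range (algebraMap F R)
  /-- `ℕ ∖ ρ_k (⋂_{i ≠ k} 𝒰_{ρᵢ})` is finite. -/
  finite_gaps : ∀ k, {d : ℕ | (d : WithBot ℕ) ∉ ρ k '' ⋂ i, ⋂ _ : i ≠ k, NearU (ρ i)}.Finite

/-- `ℒ(a) = {f | ρᵢ f ≤ aᵢ for all i}`. -/
def nearL {m : ℕ} (ρ : Fin m → R → WithBot ℕ) (a : Fin m → ℕ) : Set R :=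
  {f | ∀ i, ρ i f ≤ (a i : WithBot ℕ)}

/-- The evaluation code `C(a) = φ(ℒ(a))`. -/
def evaluationCode {m n : ℕ} (ρ : Fin m → R → WithBot ℕ) (φ : R →ₐ[F] (Fin n → F))
    (a : Fin m → ℕ) : Set (Fin n → F) :=
  φ '' nearL ρ a

end NearWeights

noncomputable section

/-! ### Curves -/

attribute [local instance] MvPolynomial.gradedAlgebra

/-- Projective `N`-space over `F`, as `Proj F[x₀, …, x_N]`. -/
abbrev projSpace (F : Type u) [Field F] (N : ℕ) : Scheme.{u} :=
  Proj (MvPolynomial.homogeneousSubmodule (Fin (N + 1)) F)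

/-- The structure morphism of projective space over `F`. -/
def projSpaceToSpec (F : Type u) [Field F] (N : ℕ) : projSpace F N ⟶ Spec (.of F) :=
  Proj.toSpecZero (MvPolynomial.homogeneousSubmodule (Fin (N + 1)) F) ≫
    Spec.map (CommRingCat.ofHom
      (algebraMap F (MvPolynomial.homogeneousSubmodule (Fin (N + 1)) F 0)))

/-- A nonsingular, geometrically irreducible, projective algebraic curve over the field `F`. -/
structure NonsingularProjectiveCurve (F : Type u) [Field F] where
  scheme : Scheme.{u}
  /-- the structure morphism -/
  hom : scheme ⟶ Spec (.of F)
  isIntegral : IsIntegral scheme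
  geometricallyIrreducible : GeometricallyIrreducible hom
  projective : ∃ (N : ℕ) (i : scheme ⟶ projSpace F N),
    IsClosedImmersion i ∧ i ≫ projSpaceToSpec F N = hom
  dim_eq_one : topologicalKrullDim scheme = 1
  nonsingular : ∀ x : scheme, IsRegularLocalRing (scheme.presheaf.stalk x)

namespace NonsingularProjectiveCurve

variable {F : Type u} [Field F] (C : NonsingularProjectiveCurve F)

instance : IsIntegral C.scheme := C.isIntegral

instance : IsLocallyNoetherian C.scheme := by
  obtain ⟨N, i, hi, -⟩ := C.projective
  let 𝒜 := MvPolynomial.homogeneousSubmodule (Fin (N + 1)) F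
  have : IsScalarTower F (𝒜 0) (MvPolynomial (Fin (N + 1)) F) :=
    ⟨fun r x y => by
      rw [Algebra.smul_def, Algebra.smul_def (A := 𝒜 0), Algebra.smul_def, Algebra.smul_def,
        map_mul, mul_assoc]
      rfl⟩
  have : Algebra.FiniteType (𝒜 0) (MvPolynomial (Fin (N + 1)) F) :=
    Algebra.FiniteType.of_restrictScalars_finiteType F _ _
  have hs : Function.Surjective (algebraMap F (𝒜 0)) := by
    rintro ⟨p, hp⟩
    have hp' : p ∈ (1 : Submodule F (MvPolynomial (Fin (N + 1)) F)) := by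
      rw [← MvPolynomial.homogeneousSubmodule_zero]; exact hp
    obtain ⟨c, hc⟩ := Submodule.mem_one.mp hp'
    exact ⟨c, Subtype.ext hc⟩
  have : IsNoetherianRing (𝒜 0) := isNoetherianRing_of_surjective F _ _ hs
  exact LocallyOfFiniteType.isLocallyNoetherian (i ≫ Proj.toSpecZero 𝒜)

/-- The function field `F(C)`. -/
abbrev functionField : Type u := C.scheme.functionField

/-- The local ring of `C` at `x`. -/
abbrev stalk (x : C.scheme) : Type u := C.scheme.presheaf.stalk x

/-- The `F`-algebra structure of the stalks (hence of the function field, which is the stalk at the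
generic point) given by the structure morphism. -/
instance stalkAlgebra (x : C.scheme) : Algebra F (C.scheme.presheaf.stalk x) :=
  ((Scheme.ΓSpecIso (.of F)).inv ≫ C.hom.appTop ≫
    C.scheme.presheaf.germ ⊤ x trivial).hom.toAlgebra

instance (x : C.scheme) : IsScalarTower F (C.stalk x) C.functionField := by
  refine IsScalarTower.of_algebraMap_eq fun c => ?_
  exact (ConcreteCategory.congr_hom (C.scheme.presheaf.germ_stalkSpecializes (U := ⊤)
    (y := x) trivial ((genericPoint_spec C.scheme).specializes trivial))
    (C.hom.appTop.hom ((Scheme.ΓSpecIso (.of F)).inv.hom c))).symm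

/-- The local ring `𝒪_x`, as a subalgebra of the function field. -/
def localRing (x : C.scheme) : Subalgebra F C.functionField :=
  (IsScalarTower.toAlgHom F (C.stalk x) C.functionField).range

/-- The (closed) points of the curve. -/
def ClosedPoint : Type u := {x : C.scheme // IsClosed {x}}

variable {C}

/-- A point is rational if its residue field is `F`. -/
def ClosedPoint.IsRational (x : C.ClosedPoint) : Prop :=
  Function.Bijective (algebraMap F (IsLocalRing.ResidueField (C.stalk x.1)))

/-- The value `f(x) ∈ F`, at a rational point `x`, of a function `f` that is regular at `x`. -/
def ClosedPoint.eval (x : C.ClosedPoint) (hx : x.IsRational) : C.localRing x.1 →ₐ[F] F :=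
  ((AlgEquiv.ofBijective (Algebra.ofId F (IsLocalRing.ResidueField (C.stalk x.1))) hx).symm :
      IsLocalRing.ResidueField (C.stalk x.1) →ₐ[F] F).comp
    ((IsScalarTower.toAlgHom F (C.stalk x.1) (IsLocalRing.ResidueField (C.stalk x.1))).comp
      ((AlgEquiv.ofInjective (IsScalarTower.toAlgHom F (C.stalk x.1) C.functionField)
        (IsFractionRing.injective (C.stalk x.1) C.functionField)).symm :
          (IsScalarTower.toAlgHom F (C.stalk x.1) C.functionField).range →ₐ[F] C.stalk x.1))

/-- Divisors on the curve. -/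
abbrev Divisor (C : NonsingularProjectiveCurve F) : Type u := C.ClosedPoint →₀ ℤ

/-- The Riemann–Roch space `L(G) = {h ≠ 0 | div h + G ≥ 0} ∪ {0}`;
`Scheme.ord h x` is the order of `h` at `x`. -/
def riemannRochSpace (G : C.Divisor) : Set C.functionField :=
  {h | h ≠ 0 → ∀ x : C.ClosedPoint, 0 ≤ Scheme.ord h x.1 + G x}

/-- The Goppa code `C_ℒ(D, G)`, for `D = P₁ + ⋯ + Pₙ` with rational points `Pᵢ`: the set of
the vectors `(h(P₁), …, h(Pₙ))`, where `h ∈ L(G)`. -/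
def goppaCode {n : ℕ} (P : Fin n → C.ClosedPoint) (hP : ∀ i, (P i).IsRational) (G : C.Divisor) :
    Set (Fin n → F) :=
  {c | ∃ h ∈ riemannRochSpace G, ∃ hreg : ∀ i, h ∈ C.localRing (P i).1,
    c = fun i => (P i).eval (hP i) ⟨h, hreg i⟩}

/-- The ring of the functions that are regular at all points except possibly `Q₁, …, Qₘ`. -/
def regularAway {m : ℕ} (Q : Fin m → C.ClosedPoint) : Subalgebra F C.functionField :=
  ⨅ x : {x : C.ClosedPoint // x ∉ Set.range Q}, C.localRing x.1.1

/-- The evaluation `φ(f) = (f(P₁), …, f(Pₙ))` on the ring of functions that are regular away from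
`Q₁, …, Qₘ`, where the `Pᵢ` are rational points different from all `Q_k`. -/
def evalMap {m n : ℕ} (Q : Fin m → C.ClosedPoint) (P : Fin n → C.ClosedPoint)
    (hP : ∀ i, (P i).IsRational) (hPQ : ∀ i k, P i ≠ Q k) :
    regularAway Q →ₐ[F] (Fin n → F) :=
  AlgHom.pi fun i => ((P i).eval (hP i)).comp
    (Subalgebra.inclusion (iInf_le
      (fun x : {x : C.ClosedPoint // x ∉ Set.range Q} => C.localRing x.1.1)
      ⟨P i, fun ⟨k, hk⟩ => hPQ i k hk.symm⟩))

/-- The pole order at `x`: `-∞` if `f = 0`, and otherwise `0` if `v_x(f) ≥ 0` and `-v_x(f)` if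
`v_x(f) < 0`. -/
def poleOrder (x : C.ClosedPoint) (f : C.functionField) : WithBot ℕ :=
  open Classical in if f = 0 then ⊥ else ((-Scheme.ord f x.1).toNat : WithBot ℕ)

end NonsingularProjectiveCurve

end

/-!
The theorem is one of function fields, once the closed points of the curve `C` are read as places of
`K = F(C)`. The properties of the places that are needed form `IsCurvePlaces`: the discrete
valuations `v_x` are trivial on `F` and pairwise incomparable, a function has finitely many poles, a
function without poles is constant, and `K` is finite over `F(f)` for every transcendental `f`.

They hold for `C` (`isCurvePlaces`) for the following reasons. A closed point of a regular curve has
a discrete valuation ring as its local ring. Two morphisms from the spectrum of a local ring to the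
separated scheme `C` that agree generically are equal, so different points have incomparable local
rings. The global sections of a proper integral scheme form a field, so a section that vanishes at a
rational point is zero; this is where the existence of some `Q_k` enters. Finiteness over `F(f)`
follows from Noether normalization and the dimension of `C`.

The core is Riemann's argument that there is a function with `Q` as its only pole
(`IsCurvePlaces.exists_single_pole`). Take `x` with a pole at `Q`, let `S` be its other poles,
and put `y = x⁻¹`. The functions regular on `S` have dimension less than `n = [K : F(y)]` modulo
those divisible by `y`, since independent elements modulo `y`, together with one more from `Q`,
are independent over `F(y)` (`card_lt_finrank`). With a basis `u_j` of `K` over `F(x)` that is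
integral over `F[x]`, the functions `x^k u_j` with `k ≤ d` span a space of dimension `n (d + 1)`
whose poles on `S` cost at most `(n - 1) (d + O(1))` conditions, so for large `d` a nonconstant
function without poles on `S` is left.

Let `f` have `Q` as its only pole. Every function is a quotient of functions integral over `F[f]`,
which again have no pole outside `Q`. Applied to a function with a simple pole at `Q`, this gives
two consecutive pole orders, and so all large ones (`exists_pole_order`): the gaps are finite in
number. The Horner scheme of an equation over `F[f]` for a function with a zero at `P` and a pole
at `P'` yields a function with `Q` as its only pole that vanishes at `P` but not at `P'`
(`exists_separating`), and the evaluation map is surjective by the usual interpolation. The axioms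
of near weights are statements about integers after taking logarithms of valuations, except for the
one on leading coefficients, which uses that `Q_k` is rational. The equality of codes is that of
the spaces of functions evaluated (`mem_riemannRochSpace_iff`).
-/

/-! ### Places of a field -/

section Places

open WithZero IntermediateField

/-- The properties of the places of a complete nonsingular curve that the argument uses: a family
`v` of discrete valuations of `K`, trivial on `F` and pairwise incomparable, such that every
function has only finitely many poles, the functions without poles are the constants, and `K` is
finite over `F(f)` for every transcendental `f`. -/
structure IsCurvePlaces (F : Type*) {K ι : Type*} [Field F] [Field K] [Algebra F K]
    (v : ι → Valuation K ℤᵐ⁰) : Prop where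
  algebraMap_le : ∀ x (c : F), v x (algebraMap F K c) ≤ 1
  separated : ∀ x y, x ≠ y → ∃ z, v x z < 1 ∧ 1 < v y z
  finite_poles : ∀ f, {x | 1 < v x f}.Finite
  const : ∀ f, (∀ x, v x f ≤ 1) → f ∈ Set.range (algebraMap F K)
  finite : ∀ f : K, Transcendental F f → FiniteDimensional F⟮f⟯ K

namespace IsCurvePlaces

variable {F K ι : Type*} [Field F] [Field K] [Algebra F K] {v : ι → Valuation K ℤᵐ⁰}

lemma map_algebraMap (h : IsCurvePlaces F v) (x : ι) {c : F} (hc : c ≠ 0) :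
    v x (algebraMap F K c) = 1 := by
  refine le_antisymm (h.algebraMap_le x c) ?_
  have h1 := h.algebraMap_le x c⁻¹
  rw [map_inv₀, map_inv₀] at h1
  have h0 : v x (algebraMap F K c) ≠ 0 := by simpa using hc
  exact (inv_le_one₀ (zero_lt_iff.mpr h0)).mp h1

lemma map_aeval_le (h : IsCurvePlaces F v) (x : ι) {f : K} (hf : v x f ≤ 1)
    (p : Polynomial F) : v x (Polynomial.aeval f p) ≤ 1 := by
  induction p using Polynomial.induction_on' with
  | add p q hp hq => rw [map_add]; exact (v x).map_add_le hp hq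
  | monomial n c =>
    rw [Polynomial.aeval_monomial, map_mul, map_pow]
    exact mul_le_one' (h.algebraMap_le x c) (pow_le_one' hf n)

lemma transcendental (h : IsCurvePlaces F v) {f : K} (hf : f ∉ Set.range (algebraMap F K)) :
    Transcendental F f := by
  intro halg
  refine hf (h.const f fun x => ?_)
  have hint : IsIntegral F f := halg.isIntegral
  obtain ⟨p, hp, hp0⟩ := hint
  have hint' : IsIntegral (v x).integer f := by
    refine ⟨p.map ((algebraMap F K).codRestrict (v x).integer (h.algebraMap_le x)),
      hp.map _, ?_⟩
    rw [Polynomial.eval₂_map]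
    exact hp0
  exact (Valuation.integer.integers (v x)).mem_of_integral hint'

lemma map_le_of_isIntegral_adjoin (h : IsCurvePlaces F v) {x : ι} {f g : K} (hf : v x f ≤ 1)
    (hg : IsIntegral (Algebra.adjoin F {f}) g) : v x g ≤ 1 := by
  obtain ⟨p, hp, hp0⟩ := hg
  have hA : ∀ a : Algebra.adjoin F {f}, v x (a : K) ≤ 1 := by
    rintro ⟨a, ha⟩
    rw [Algebra.adjoin_singleton_eq_range_aeval] at ha
    obtain ⟨q, rfl⟩ := ha
    exact h.map_aeval_le x hf q
  have hint' : IsIntegral (v x).integer g := by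
    refine ⟨p.map ((algebraMap (Algebra.adjoin F {f}) K).codRestrict (v x).integer hA),
      hp.map _, ?_⟩
    rw [Polynomial.eval₂_map]
    exact hp0
  exact (Valuation.integer.integers (v x)).mem_of_integral hint'

/-- A function with a zero at `Q` and poles at finitely many prescribed other places. -/
lemma exists_zero_poles (h : IsCurvePlaces F v) (Q : ι) (S : Finset ι) (hS : Q ∉ S) :
    ∃ z, v Q z < 1 ∧ ∀ T ∈ S, 1 < v T z := by
  classical
  induction S using Finset.induction_on with
  | empty => exact ⟨0, by simp, by simp⟩
  | insert T' S hT' ih =>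
    simp only [Finset.mem_insert, not_or] at hS
    obtain ⟨z, hzQ, hz⟩ := ih hS.2
    by_cases hT : 1 < v T' z
    · exact ⟨z, hzQ, by simpa [hT] using hz⟩
    obtain ⟨w, hwQ, hw⟩ := h.separated Q T' hS.1
    -- for each place in `S` at most one power of `w` can cancel the pole of `z`
    have hfin : (⋃ T ∈ S, {r : ℕ | v T z = v T (w ^ r)}).Finite := by
      refine S.finite_toSet.biUnion fun T hTS => Set.Subsingleton.finite ?_
      intro r hr s hs
      simp only [Set.mem_ofPred_eq, map_pow] at hr hs
      have h1 : 1 < v T w := by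
        by_contra! hle
        exact absurd (hz T hTS) (not_lt.mpr (hr ▸ pow_le_one' hle r))
      exact (pow_right_strictMono₀ h1).injective (hr.symm.trans hs)
    obtain ⟨r, hr⟩ := (hfin.union (Set.finite_singleton 0)).infinite_compl.nonempty
    simp only [Set.mem_compl_iff, Set.mem_union, Set.mem_iUnion, Set.mem_ofPred_eq, not_or,
      Set.mem_singleton_iff, not_exists] at hr
    refine ⟨z + w ^ r, ?_, ?_⟩
    · refine (v Q).map_add_lt hzQ ?_
      rw [map_pow]
      exact pow_lt_one₀ zero_le hwQ hr.2
    · intro T hTS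
      rcases Finset.mem_insert.mp hTS with rfl | hTS
      · have h1 : 1 < v T (w ^ r) := by rw [map_pow]; exact one_lt_pow₀ hw hr.2
        rwa [(v T).map_add_eq_of_lt_right ((not_lt.mp hT).trans_lt h1)]
      · rw [(v T).map_add_of_distinct_val (hr.1 T hTS)]
        exact lt_max_of_lt_left (hz T hTS)

/-- Weak approximation of `0` at `Q` and of `1` at finitely many other places. -/
lemma exists_approx (h : IsCurvePlaces F v) (Q : ι) (S : Finset ι) (hS : Q ∉ S)
    {γ : ℤᵐ⁰} (hγ : γ ≠ 0) : ∃ e, v Q e ≤ γ ∧ ∀ T ∈ S, v T (1 - e) ≤ γ := by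
  classical
  obtain ⟨z, hzQ, hz⟩ := h.exists_zero_poles Q S hS
  have key : ∀ a : ℤᵐ⁰, a < 1 → ∃ N, ∀ n ≥ N, a ^ n ≤ γ := fun a ha => by
    obtain ⟨N, hN⟩ := exists_pow_lt₀ ha (Units.mk0 γ hγ)
    exact ⟨N, fun n hn => (pow_le_pow_right_of_le_one' ha.le hn).trans hN.le⟩
  obtain ⟨N, hN⟩ := key _ hzQ
  have key2 : ∀ T ∈ S, ∃ N, ∀ n ≥ N, (v T z)⁻¹ ^ n ≤ γ := fun T hT =>
    key _ (inv_lt_one_of_one_lt₀ (hz T hT))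
  choose! N' hN' using key2
  set M := 1 + N + S.sup N' with hM
  have hM0 : M ≠ 0 := by omega
  refine ⟨z ^ M / (1 + z ^ M), ?_, fun T hT => ?_⟩
  · have h1 : v Q (1 + z ^ M) = 1 := by
      refine (v Q).map_one_add_of_lt ?_
      rw [map_pow]
      exact pow_lt_one₀ zero_le hzQ hM0
    rw [map_div₀, h1, div_one, map_pow]
    exact hN M (by omega)
  · have h1 : 1 < v T (z ^ M) := by rw [map_pow]; exact one_lt_pow₀ (hz T hT) hM0
    have h2 : v T (1 + z ^ M) = v T (z ^ M) :=
      (v T).map_add_eq_of_lt_right (by rwa [map_one])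
    have h3 : 1 + z ^ M ≠ 0 := fun h0 => by
      rw [h0, map_zero] at h2; rw [← h2] at h1; exact absurd h1 (by simp)
    have h4 : 1 - z ^ M / (1 + z ^ M) = (1 + z ^ M)⁻¹ := by field_simp; ring
    rw [h4, map_inv₀, h2, map_pow, ← inv_pow]
    have := Finset.le_sup (f := N') hT
    exact hN' T hT M (by omega)

end IsCurvePlaces

end Places

/-! ### Linear independence over a simple transcendental extension -/

section LinearAlgebra

open Polynomial IntermediateField

variable {F K : Type*} [Field F] [Field K] [Algebra F K]

/-- Elements of an `F[y]`-submodule `B` of `K` that are linearly independent over `F` modulo `yB`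
are linearly independent over `F(y)`. -/
lemma linearIndependent_adjoin_of_mod {ι : Type*} [Fintype ι] {y : K} (hy : y ≠ 0)
    (B : Submodule F K) (hB : ∀ b ∈ B, y * b ∈ B) (c : ι → K) (hc : ∀ i, c i ∈ B)
    (hind : ∀ a : ι → F, (∃ b ∈ B, ∑ i, a i • c i = y * b) → ∀ i, a i = 0) :
    LinearIndependent F⟮y⟯ c := by
  have hBp : ∀ (p : F[X]), ∀ b ∈ B, aeval y p * b ∈ B := by
    intro p b hb
    induction p using Polynomial.induction_on with
    | C a => rw [aeval_C, ← Algebra.smul_def]; exact B.smul_mem _ hb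
    | add p q hp hq => rw [map_add, add_mul]; exact B.add_mem hp hq
    | monomial n a ih =>
      rw [pow_succ, ← mul_assoc, map_mul, aeval_X, mul_comm _ y, mul_assoc]
      exact hB _ ih
  have key : ∀ (N : ℕ) (p : ι → F[X]), (∀ i, (p i).natDegree ≤ N) →
      ∑ i, aeval y (p i) * c i = 0 → ∀ i, p i = 0 := by
    intro N
    induction N with
    | zero =>
      intro p hp h0 i
      have hpC : ∀ i, p i = C ((p i).coeff 0) := fun i => eq_C_of_natDegree_le_zero (hp i)
      have := hind (fun i => (p i).coeff 0) ⟨0, B.zero_mem, ?_⟩ i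
      · rw [hpC i, this, C_0]
      · rw [mul_zero, ← h0]
        refine Finset.sum_congr rfl fun i _ => ?_
        conv_rhs => rw [hpC i, aeval_C, ← Algebra.smul_def]
    | succ N ih =>
      intro p hp h0
      have hsplit : ∑ i, aeval y (p i) * c i
          = ∑ i, (p i).coeff 0 • c i + y * ∑ i, aeval y (p i).divX * c i := by
        rw [Finset.mul_sum, ← Finset.sum_add_distrib]
        refine Finset.sum_congr rfl fun i _ => ?_
        conv_lhs => rw [← divX_mul_X_add (p i)]
        rw [map_add, map_mul, aeval_X, aeval_C, Algebra.smul_def]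
        ring
      have h1 : ∀ i, (p i).coeff 0 = 0 := by
        refine hind _ ⟨-∑ i, aeval y (p i).divX * c i,
          B.neg_mem (B.sum_mem fun i _ => hBp _ _ (hc i)), ?_⟩
        rw [mul_neg, eq_neg_iff_add_eq_zero, ← hsplit, h0]
      rw [hsplit, Finset.sum_eq_zero (fun i _ => by rw [h1 i, zero_smul]), zero_add] at h0
      have h2 := ih (fun i => (p i).divX) (fun i => by
        rw [natDegree_divX_eq_natDegree_tsub_one]; have := hp i; omega)
        ((mul_eq_zero.mp h0).resolve_left hy)
      intro i
      rw [← divX_mul_X_add (p i), h2 i, h1 i]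
      simp
  have hlin : LinearIndependent (Algebra.adjoin F {y}) c := by
    rw [Fintype.linearIndependent_iff]
    intro g hg i
    have hg' : ∀ j, ∃ p : F[X], aeval y p = (g j : K) := fun j =>
      (Algebra.adjoin_singleton_eq_range_aeval F y).le (g j).2
    choose p hp using hg'
    have := key (Finset.univ.sup fun i => (p i).natDegree) p
      (fun i => Finset.le_sup (f := fun i => (p i).natDegree) (Finset.mem_univ i)) ?_ i
    · ext
      rw [← hp i, this]
      simp
    · rw [← hg]
      exact Finset.sum_congr rfl fun j _ => by rw [hp j]; rfl
  open scoped IntermediateField.algebraAdjoinAdjoin in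
  exact (LinearIndependent.iff_fractionRing (Algebra.adjoin F {y}) F⟮y⟯).mp hlin

end LinearAlgebra

/-! ### Functions with a single pole -/

section SinglePole

open WithZero IntermediateField Module

/-- Finitely many nonzero values have a nonzero lower bound. -/
lemma exists_ne_zero_forall_le {α : Type*} (s : Finset α) (f : α → ℤᵐ⁰) (hf : ∀ i ∈ s, f i ≠ 0) :
    ∃ γ : ℤᵐ⁰, γ ≠ 0 ∧ ∀ i ∈ s, γ ≤ f i := by
  classical
  induction s using Finset.induction_on with
  | empty => exact ⟨1, one_ne_zero, by simp⟩
  | insert i s _ ih =>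
    obtain ⟨γ, h0, h⟩ := ih fun j hj => hf j (Finset.mem_insert_of_mem hj)
    refine ⟨min γ (f i), ?_, fun j hj => ?_⟩
    · rcases min_choice γ (f i) with h1 | h1 <;> rw [h1]
      exacts [h0, hf i (Finset.mem_insert_self i s)]
    · rcases Finset.mem_insert.mp hj with rfl | hj
      exacts [min_le_right _ _, (min_le_left _ _).trans (h j hj)]

namespace IsCurvePlaces

variable {F K ι : Type*} [Field F] [Field K] [Algebra F K] {v : ι → Valuation K ℤᵐ⁰}

/-- The functions whose poles at the places `T ∈ S` are at most those of `γ T`. -/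
def lattice (h : IsCurvePlaces F v) (S : Set ι) (γ : ι → ℤᵐ⁰) : Submodule F K where
  carrier := {w | ∀ T ∈ S, v T w ≤ γ T}
  add_mem' ha hb T hT := (v T).map_add_le (ha T hT) (hb T hT)
  zero_mem' T _ := by simp
  smul_mem' c w hw T hT := by
    rw [Algebra.smul_def, map_mul]
    exact (mul_le_of_le_one_left' (h.algebraMap_le T c)).trans (hw T hT)

/-- If `y` vanishes at `Q` and on `S`, then the functions regular on `S` modulo those divisible by
`y` form a space of dimension less than `[K : F(y)]`: the zero of `y` at `Q` contributes one
further independent element. -/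
lemma card_lt_finrank (h : IsCurvePlaces F v) {Q : ι} {S : Finset ι} (hS : Q ∉ S) {y : K}
    (hy : y ≠ 0) (hyQ : v Q y < 1) (hyS : ∀ T ∈ S, v T y < 1) [FiniteDimensional F⟮y⟯ K]
    {κ : Type*} [Fintype κ] (b : κ → K) (hb : ∀ i, ∀ T ∈ S, v T (b i) ≤ 1)
    (hind : ∀ a : κ → F, (∀ T ∈ S, v T (∑ i, a i • b i) ≤ v T y) → ∀ i, a i = 0) :
    Fintype.card κ < finrank F⟮y⟯ K := by
  classical
  have hvy : ∀ T, v T y ≠ 0 := fun T => (Valuation.ne_zero_iff _).mpr hy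
  obtain ⟨γ₁, h10, h1⟩ := exists_ne_zero_forall_le (insert Q S) (fun T => v T y)
    (fun T _ => hvy T)
  obtain ⟨γ₂, h20, h2⟩ := exists_ne_zero_forall_le Finset.univ
    (fun i => if b i = 0 then 1 else (v Q (b i))⁻¹) (fun i _ => by
      split_ifs with hi
      · exact one_ne_zero
      · simpa using hi)
  obtain ⟨e, heQ, heS⟩ := h.exists_approx Q S hS (γ := min γ₁ γ₂)
    (by rcases min_choice γ₁ γ₂ with h | h <;> rw [h] <;> assumption)
  have heQy : v Q e < 1 :=
    ((heQ.trans (min_le_left _ _)).trans (h1 Q (Finset.mem_insert_self _ _))).trans_lt hyQ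
  have heT : ∀ T ∈ S, v T (1 - e) ≤ v T y := fun T hT =>
    ((heS T hT).trans (min_le_left _ _)).trans (h1 T (Finset.mem_insert_of_mem hT))
  have heT1 : ∀ T ∈ S, v T e ≤ 1 := fun T hT => by
    have : e = 1 - (1 - e) := by ring
    rw [this]
    exact (v T).map_sub_le (by simp) ((heT T hT).trans (hyS T hT).le)
  have hebQ : ∀ i, v Q (b i * e) ≤ 1 := fun i => by
    by_cases hi : b i = 0
    · simp [hi]
    have := heQ.trans ((min_le_right _ _).trans (h2 i (Finset.mem_univ i)))
    rw [if_neg hi] at this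
    rw [map_mul]
    calc v Q (b i) * v Q e ≤ v Q (b i) * (v Q (b i))⁻¹ := mul_le_mul_right this _
      _ = 1 := mul_inv_cancel₀ (by simpa using hi)
  have heQ1 : v Q (1 - e) = 1 := (v Q).map_one_sub_of_lt heQy
  let B := h.lattice (insert Q (S : Set ι)) 1
  let c : Option κ → K := fun o => o.elim (1 - e) fun i => b i * e
  have hmem : ∀ w : K, v Q w ≤ 1 → (∀ T ∈ S, v T w ≤ 1) → w ∈ B := by
    intro w hQ hT T hT'
    rcases hT' with rfl | hT'
    exacts [hQ, hT T hT']
  have hlin : LinearIndependent F⟮y⟯ c := by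
    refine linearIndependent_adjoin_of_mod hy B (fun w hw => hmem _ ?_ fun T hT => ?_) c
      (fun o => ?_) fun a ha => ?_
    · rw [map_mul]; exact mul_le_one' hyQ.le (hw Q (Set.mem_insert _ _))
    · rw [map_mul]
      exact mul_le_one' (hyS T hT).le (hw T (Set.mem_insert_of_mem _ hT))
    · cases o with
      | none => exact hmem _ heQ1.le fun T hT => (heT T hT).trans (hyS T hT).le
      | some i =>
        refine hmem _ (hebQ i) fun T hT => ?_
        change v T (b i * e) ≤ 1
        rw [map_mul]
        exact mul_le_one' (hb i T hT) (heT1 T hT)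
    · obtain ⟨w, hw, haw⟩ := ha
      rw [Fintype.sum_option] at haw
      simp only [c, Option.elim] at haw
      have hsum : ∑ i, a (some i) • (b i * e) = (∑ i, a (some i) • b i) * e := by
        rw [Finset.sum_mul]
        exact Finset.sum_congr rfl fun i _ => (smul_mul_assoc _ _ _).symm
      rw [hsum] at haw
      set σ := ∑ i, a (some i) • b i with hσ
      have hσT : ∀ T ∈ S, v T σ ≤ 1 := fun T hT =>
        (h.lattice (S : Set ι) 1).sum_mem
          (fun i _ => Submodule.smul_mem _ _ fun T hT => hb i T hT) T hT
      have hsome : ∀ i, a (some i) = 0 := by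
        refine hind (fun i => a (some i)) fun T hT => ?_
        have h3 : σ = σ * (1 - e) + y * w - algebraMap F K (a none) * (1 - e) := by
          rw [← haw, Algebra.smul_def]; ring
        rw [← hσ, h3]
        refine (v T).map_sub_le ((v T).map_add_le ?_ ?_) ?_ <;> rw [map_mul]
        · exact (mul_le_of_le_one_left' (hσT T hT)).trans (heT T hT)
        · exact mul_le_of_le_one_right' (hw T (Set.mem_insert_of_mem _ hT))
        · exact (mul_le_of_le_one_left' (h.algebraMap_le T _)).trans (heT T hT)
      have hnone : a none = 0 := by
        by_contra hne
        have hσ0 : σ = 0 := Finset.sum_eq_zero fun i _ => by rw [hsome i, zero_smul]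
        rw [hσ0, zero_mul, add_zero, Algebra.smul_def] at haw
        have := congrArg (v Q) haw
        rw [map_mul, map_mul, heQ1, mul_one, h.map_algebraMap Q hne] at this
        exact absurd this (ne_of_gt
          ((mul_le_of_le_one_right' (hw Q (Set.mem_insert _ _))).trans_lt hyQ))
      intro o
      cases o
      exacts [hnone, hsome _]
  have := hlin.fintype_card_le_finrank
  rw [Fintype.card_option] at this
  omega

/-- Allowing the poles on `S` to increase by those of `x` enlarges a space of functions by less than
`[K : F(x⁻¹)]` dimensions, if `x` has a further pole `Q`. -/
lemma finrank_lt_of_le_lattice (h : IsCurvePlaces F v) {Q : ι} {S : Finset ι} (hS : Q ∉ S) {x : K}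
    (hxQ : 1 < v Q x) (hxS : ∀ T ∈ S, 1 < v T x) [FiniteDimensional F⟮x⁻¹⟯ K] (M : ℕ)
    (W : Submodule F K) [FiniteDimensional F W]
    (hW : W ≤ h.lattice S fun T => v T x ^ (M + 1)) :
    finrank F W <
      finrank F (W ⊓ h.lattice S fun T => v T x ^ M : Submodule F K) + finrank F⟮x⁻¹⟯ K := by
  have hx : x ≠ 0 := fun h0 => by simp [h0] at hxQ
  have hvx : ∀ T, v T x ≠ 0 := fun T => (Valuation.ne_zero_iff _).mpr hx
  set L := h.lattice (S : Set ι) fun T => v T x ^ M with hL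
  let N := L.comap W.subtype
  have hN : finrank F (W ⊓ L : Submodule F K) = finrank F N := by
    rw [← Submodule.map_comap_subtype]
    exact Submodule.finrank_map_subtype_eq _ _
  rw [hN, ← N.finrank_quotient_add_finrank, add_comm, Nat.add_lt_add_iff_left]
  let β := Module.finBasis F (W ⧸ N)
  choose w hw using fun i => N.mkQ_surjective (β i)
  have := h.card_lt_finrank hS (inv_ne_zero hx)
    (by rw [map_inv₀]; exact inv_lt_one_of_one_lt₀ hxQ)
    (fun T hT => by rw [map_inv₀]; exact inv_lt_one_of_one_lt₀ (hxS T hT))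
    (fun i => x⁻¹ ^ (M + 1) * (w i : K)) (fun i T hT => ?_) fun a ha => ?_
  · simpa using this
  · rw [map_mul, map_pow, map_inv₀, inv_pow]
    calc _ ≤ (v T x ^ (M + 1))⁻¹ * v T x ^ (M + 1) := mul_le_mul_right (hW (w i).2 T hT) _
      _ = 1 := inv_mul_cancel₀ (pow_ne_zero _ (hvx T))
  · have hmem : ∑ i, a i • w i ∈ N := by
      change ((∑ i, a i • w i : W) : K) ∈ L
      intro T hT
      have h1 := ha T hT
      have h2 : ∑ i, a i • (x⁻¹ ^ (M + 1) * (w i : K))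
          = x⁻¹ ^ (M + 1) * ((∑ i, a i • w i : W) : K) := by
        simp [Finset.mul_sum]
      rw [h2, pow_succ, mul_assoc, mul_left_comm, map_mul] at h1
      have h3 := (mul_le_iff_le_one_right (zero_lt_iff.mpr
        ((Valuation.ne_zero_iff _).mpr (inv_ne_zero hx)))).mp h1
      rw [map_mul, map_pow, map_inv₀, inv_pow] at h3
      exact (inv_mul_le_one₀ (zero_lt_iff.mpr (pow_ne_zero _ (hvx T)))).mp h3
    have h4 : ∑ i, a i • β i = 0 := by
      rw [← (Submodule.Quotient.mk_eq_zero N).mpr hmem, ← Submodule.mkQ_apply, map_sum]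
      exact Finset.sum_congr rfl fun i _ => by rw [map_smul, hw]
    exact Fintype.linearIndependent_iff.mp β.linearIndependent a h4

lemma finrank_add_le_of_le_lattice (h : IsCurvePlaces F v) {Q : ι} {S : Finset ι} (hS : Q ∉ S)
    {x : K} (hxQ : 1 < v Q x) (hxS : ∀ T ∈ S, 1 < v T x) [FiniteDimensional F⟮x⁻¹⟯ K] (M : ℕ)
    (W : Submodule F K) [FiniteDimensional F W] (hW : W ≤ h.lattice S fun T => v T x ^ M) :
    finrank F W + M ≤ finrank F (W ⊓ h.lattice S 1 : Submodule F K) + M * finrank F⟮x⁻¹⟯ K := by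
  induction M generalizing W with
  | zero =>
    rw [inf_eq_left.mpr]
    · simp
    · intro w hw T hT
      simpa using hW hw T hT
  | succ M ih =>
    have h1 := h.finrank_lt_of_le_lattice hS hxQ hxS M W hW
    have h2 := ih (W ⊓ h.lattice S fun T => v T x ^ M) inf_le_right
    have h3 : finrank F (W ⊓ (h.lattice S fun T => v T x ^ M) ⊓ h.lattice S 1 : Submodule F K) ≤
        finrank F (W ⊓ h.lattice S 1 : Submodule F K) :=
      Submodule.finrank_mono (inf_le_inf_right _ inf_le_left)
    rw [add_mul, one_mul]
    omega

end IsCurvePlaces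

/-- For `K` finite over `F(x)` with `x` transcendental, the functions `xᵏ uⱼ`, where `k ≤ d` and
the `uⱼ` are a basis of `K` over `F(x)` that is integral over `F[x]`, span spaces whose dimensions
grow like `d [K : F(x)]`. -/
lemma exists_basis_isIntegral {F K : Type*} [Field F] [Field K] [Algebra F K] {x : K}
    (hx : Transcendental F x) [FiniteDimensional F⟮x⟯ K] :
    ∃ (s : Finset K) (u : s → K), s.card = finrank F⟮x⟯ K ∧
      (∀ j, IsIntegral (Algebra.adjoin F {x}) (u j)) ∧
      ∀ d : ℕ, LinearIndependent F fun p : Fin (d + 1) × s => x ^ (p.1 : ℕ) * u p.2 := by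
  open scoped IntermediateField.algebraAdjoinAdjoin in
  obtain ⟨s, b, hb⟩ := FiniteDimensional.exists_is_basis_integral (Algebra.adjoin F {x}) F⟮x⟯ K
  refine ⟨s, b, by rw [finrank_eq_card_basis b, Fintype.card_coe], hb, fun d => ?_⟩
  have hpow : LinearIndependent F fun k : Fin (d + 1) => AdjoinSimple.gen F x ^ (k : ℕ) := by
    refine LinearIndependent.of_comp F⟮x⟯.val.toLinearMap ?_
    have h1 := (Polynomial.basisMonomials F).linearIndependent.map'
      (Polynomial.aeval x).toLinearMap
      (LinearMap.ker_eq_bot.mpr (transcendental_iff_injective.mp hx))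
    have h2 := h1.comp (fun k : Fin (d + 1) => (k : ℕ)) Fin.val_injective
    change LinearIndependent F fun k : Fin (d + 1) => x ^ (k : ℕ)
    simpa [Function.comp_def, Polynomial.aeval_monomial] using h2
  exact linearIndependent_smul hpow b.linearIndependent

namespace IsCurvePlaces

variable {F K ι : Type*} [Field F] [Field K] [Algebra F K] {v : ι → Valuation K ℤᵐ⁰}

lemma notMem_range_of_one_lt (h : IsCurvePlaces F v) {Q : ι} {f : K} (hf : 1 < v Q f) :
    f ∉ Set.range (algebraMap F K) := by
  rintro ⟨c, rfl⟩
  exact absurd (h.algebraMap_le Q c) (not_le.mpr hf)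

/-- Every place `Q` with a function that has a pole there is the only pole of some function. Among
the functions of pole order at most `d` times that of `x` outside `Q` and arbitrary at `Q`, enough
have no pole outside `Q`. -/
theorem exists_single_pole (h : IsCurvePlaces F v) {Q : ι} {x : K} (hxQ : 1 < v Q x) :
    ∃ f, 1 < v Q f ∧ ∀ T, T ≠ Q → v T f ≤ 1 := by
  classical
  have hxc := h.notMem_range_of_one_lt hxQ
  have hxt := h.transcendental hxc
  have := h.finite x hxt
  let S : Finset ι := (h.finite_poles x).toFinset.erase Q
  have hSmem : ∀ T, T ∈ S ↔ T ≠ Q ∧ 1 < v T x := fun T => by simp [S]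
  have hQS : Q ∉ S := fun hQ => ((hSmem Q).mp hQ).1 rfl
  have hxS : ∀ T ∈ S, 1 < v T x := fun T hT => ((hSmem T).mp hT).2
  obtain ⟨κ, u, hcard, hu, hli⟩ := exists_basis_isIntegral hxt
  have hE : F⟮x⁻¹⟯ = F⟮x⟯ := by
    apply le_antisymm <;> rw [adjoin_simple_le_iff]
    · exact inv_mem (mem_adjoin_simple_self F x)
    · simpa using inv_mem (mem_adjoin_simple_self F x⁻¹)
  have hn : finrank F⟮x⁻¹⟯ K = finrank F⟮x⟯ K := by rw [hE]
  have : FiniteDimensional F⟮x⁻¹⟯ K := by rwa [hE]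
  -- a common bound `x ^ e` for the poles of the `u j` on `S`
  have hkey : ∀ p : κ × ι, p.2 ∈ S → ∃ N, ∀ n ≥ N, v p.2 (u p.1) ≤ v p.2 x ^ n := by
    rintro ⟨j, T⟩ hT
    by_cases h0 : v T (u j) = 0
    · exact ⟨0, fun n _ => by simp [h0]⟩
    obtain ⟨N, hN⟩ := exists_pow_lt₀ (inv_lt_one_of_one_lt₀ (hxS T hT))
      (Units.mk0 (v T (u j))⁻¹ (inv_ne_zero h0))
    refine ⟨N, fun n hn => ?_⟩
    simp only [Units.val_mk0, inv_pow] at hN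
    have := (inv_lt_inv₀ (pow_pos (zero_lt_one.trans (hxS T hT)) N) (zero_lt_iff.mpr h0)).mp hN
    exact this.le.trans (pow_le_pow_right₀ (hxS T hT).le hn)
  choose! N hN using hkey
  set e := (Finset.univ ×ˢ S).sup N with he
  have hue : ∀ j, ∀ T ∈ S, v T (u j) ≤ v T x ^ e := fun j T hT =>
    hN (j, T) hT e (Finset.le_sup (f := N) (by simp [hT]))
  set n := finrank F⟮x⟯ K with hn'
  obtain ⟨d, h2⟩ : ∃ d, d = n * e + 1 := ⟨_, rfl⟩
  let w : Fin (d + 1) × κ → K := fun p => x ^ (p.1 : ℕ) * u p.2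
  let W := Submodule.span F (Set.range w)
  have hWdim : finrank F W = (d + 1) * n := by
    rw [finrank_span_eq_card (hli d), Fintype.card_prod, Fintype.card_fin, Fintype.card_coe, hcard]
  have : FiniteDimensional F W := FiniteDimensional.span_of_finite F (Set.finite_range w)
  have hWle : W ≤ h.lattice S fun T => v T x ^ (d + e) := by
    rw [Submodule.span_le]
    rintro _ ⟨⟨k, j⟩, rfl⟩ T hT
    change v T (x ^ (k : ℕ) * u j) ≤ v T x ^ (d + e)
    rw [map_mul, map_pow, pow_add]
    exact mul_le_mul' (pow_le_pow_right₀ (hxS T hT).le (by omega)) (hue j T hT)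
  have hcount := h.finrank_add_le_of_le_lattice hQS hxQ hxS (d + e) W hWle
  rw [hWdim, hn] at hcount
  have htwo : 1 < finrank F (W ⊓ h.lattice S 1 : Submodule F K) := by
    have hn1 : 0 < n := finrank_pos
    rw [add_mul d, add_mul d] at hcount
    linarith
  obtain ⟨f, hf, hfc⟩ : ∃ f ∈ (W ⊓ h.lattice S 1 : Submodule F K),
      f ∉ Set.range (algebraMap F K) := by
    by_contra! hall
    have hle : (W ⊓ h.lattice S 1 : Submodule F K) ≤ Submodule.span F {1} := fun f hf => by
      obtain ⟨c, rfl⟩ := hall f hf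
      rw [Submodule.mem_span_singleton]
      exact ⟨c, (Algebra.algebraMap_eq_smul_one c).symm⟩
    have := (Submodule.finrank_mono hle).trans (finrank_span_le_card _)
    simp at this
    omega
  have hreg : ∀ T, T ≠ Q → v T f ≤ 1 := fun T hT => by
    by_cases hTS : T ∈ S
    · exact hf.2 T hTS
    have hTx : v T x ≤ 1 := by
      by_contra! hlt
      exact hTS ((hSmem T).mpr ⟨hT, hlt⟩)
    have hWT : W ≤ h.lattice {T} 1 := by
      rw [Submodule.span_le]
      rintro _ ⟨⟨k, j⟩, rfl⟩ T' rfl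
      change v T' (x ^ (k : ℕ) * u j) ≤ 1
      rw [map_mul, map_pow]
      exact mul_le_one' (pow_le_one' hTx _) (h.map_le_of_isIntegral_adjoin hTx (hu j))
    exact hWT hf.1 T rfl
  refine ⟨f, ?_, hreg⟩
  by_contra! hQ
  refine hfc (h.const f fun T => ?_)
  by_cases hT : T = Q
  · rwa [hT]
  · exact hreg T hT

/-- Every function is a quotient of functions whose only pole is `Q`. -/
lemma exists_div_eq (h : IsCurvePlaces F v) {Q : ι} {f : K} (hfQ : 1 < v Q f)
    (hf : ∀ T, T ≠ Q → v T f ≤ 1) (g : K) :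
    ∃ a b, (∀ T, T ≠ Q → v T a ≤ 1) ∧ (∀ T, T ≠ Q → v T b ≤ 1) ∧ b ≠ 0 ∧ g = a / b := by
  have hfc := h.notMem_range_of_one_lt hfQ
  have := h.finite f (h.transcendental hfc)
  open scoped IntermediateField.algebraAdjoinAdjoin in
  obtain ⟨y, hy, hint⟩ := exists_integral_multiples (Algebra.adjoin F {f}) F⟮f⟯ (L := K) {g}
  have hy0 : (y : K) ≠ 0 := fun h0 => hy (Subtype.ext h0)
  have hint := hint g (Finset.mem_singleton_self g)
  refine ⟨y • g, y, fun T hT => h.map_le_of_isIntegral_adjoin (hf T hT) hint,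
    fun T hT => h.map_le_of_isIntegral_adjoin (hf T hT) ?_, hy0, ?_⟩
  · exact isIntegral_algebraMap (x := y)
  · change g = (y : K) * g / y
    rw [mul_div_cancel_left₀ _ hy0]

lemma one_le_map (h : IsCurvePlaces F v) {Q : ι} {f : K} (hf : ∀ T, T ≠ Q → v T f ≤ 1)
    (h0 : f ≠ 0) : 1 ≤ v Q f := by
  by_contra! hlt
  obtain ⟨c, rfl⟩ := h.const f fun T => by
    by_cases hT : T = Q
    · exact hT ▸ hlt.le
    · exact hf T hT
  exact hlt.ne (h.map_algebraMap Q fun hc => h0 (by rw [hc, map_zero]))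

/-- All large numbers are pole orders of functions whose only pole is `Q`: two consecutive numbers
are, since a function with a simple pole at `Q` is a quotient of functions whose only pole is
`Q`. -/
theorem exists_pole_order (h : IsCurvePlaces F v) {Q : ι} {x : K} (hx : v Q x = exp 1) :
    ∃ d₀ : ℕ, ∀ d ≥ d₀, ∃ f, v Q f = exp (d : ℤ) ∧ ∀ T, T ≠ Q → v T f ≤ 1 := by
  obtain ⟨f, hfQ, hf⟩ := h.exists_single_pole (Q := Q) (x := x)
    (by rw [hx, ← exp_zero, exp_lt_exp]; exact one_pos)
  obtain ⟨a, b, ha, hb, hb0, rfl⟩ := h.exists_div_eq hfQ hf x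
  have ha0 : a ≠ 0 := fun h0 => by
    rw [h0, zero_div, map_zero] at hx
    exact exp_ne_zero hx.symm
  have hex : ∀ g : K, 1 ≤ v Q g → ∃ s : ℕ, v Q g = exp (s : ℤ) := fun g hg => by
    have h0 : v Q g ≠ 0 := fun h0 => by simp [h0] at hg
    refine ⟨(log (v Q g)).toNat, ?_⟩
    rw [Int.toNat_of_nonneg, exp_log h0]
    rwa [← log_one, log_le_log one_ne_zero h0]
  obtain ⟨s, hs⟩ := hex b (h.one_le_map hb hb0)
  have hs' : v Q a = exp ((s + 1 : ℕ) : ℤ) := by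
    rw [map_div₀, div_eq_iff ((Valuation.ne_zero_iff _).mpr hb0), hs, ← exp_add] at hx
    rw [hx]
    push_cast
    rw [add_comm]
  refine ⟨s * s, fun d hd => ?_⟩
  obtain ⟨i, j, hij⟩ : ∃ i j : ℕ, d = i * s + j * (s + 1) := by
    rcases Nat.eq_zero_or_pos s with rfl | hs0
    · exact ⟨0, d, by simp⟩
    refine ⟨d / s - d % s, d % s, ?_⟩
    have h1 : d % s ≤ d / s := (Nat.mod_lt d hs0).le.trans ((Nat.le_div_iff_mul_le hs0).mpr hd)
    have h2 := Nat.div_add_mod d s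
    zify [h1] at h2 ⊢
    linarith
  refine ⟨b ^ i * a ^ j, ?_, fun T hT => ?_⟩
  · rw [map_mul, map_pow, map_pow, hs, hs', ← exp_nsmul, ← exp_nsmul, ← exp_add, hij]
    simp
  · rw [map_mul, map_pow, map_pow]
    exact mul_le_one' (pow_le_one' (hb T hT) _) (pow_le_one' (ha T hT) _)

end IsCurvePlaces

/-- The partial sums `zᵏcₙ + ⋯ + cₙ₋ₖ` of a root `z` of a polynomial with coefficients in a
valuation ring lie in that ring, for either `v z ≤ 1` or one divides by `z` repeatedly. -/
lemma Valuation.map_aeval_divX_iterate_le {R K Γ : Type*} [CommRing R] [Field K] [Algebra R K]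
    [LinearOrderedCommGroupWithZero Γ] (w : Valuation K Γ) (hR : ∀ r : R, w (algebraMap R K r) ≤ 1)
    {z : K} {p : Polynomial R} (hp : Polynomial.aeval z p = 0) (m : ℕ) :
    w (Polynomial.aeval z (Polynomial.divX^[m] p)) ≤ 1 := by
  open Polynomial in
  rcases le_or_gt (w z) 1 with hz | hz
  · have : ∀ q : R[X], w (aeval z q) ≤ 1 := fun q => by
      induction q using Polynomial.induction_on' with
      | add p q hp hq => rw [map_add]; exact w.map_add_le hp hq
      | monomial n c =>
        rw [aeval_monomial, map_mul, map_pow]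
        exact mul_le_one' (hR c) (pow_le_one' hz n)
    exact this _
  · induction m with
    | zero => simp [hp]
    | succ m ih =>
      rw [Function.iterate_succ_apply']
      set q := divX^[m] p
      have h1 : aeval z q.divX * z = aeval z q - algebraMap R K (q.coeff 0) := by
        conv_rhs => rw [← divX_mul_X_add q]
        simp
      have h2 : w (aeval z q.divX * z) ≤ 1 := by
        rw [h1]; exact w.map_sub_le ih (hR _)
      rw [map_mul] at h2
      by_contra! h3
      exact absurd h2 (not_le.mpr (one_lt_mul'' h3 hz))

namespace IsCurvePlaces

variable {F K ι : Type*} [Field F] [Field K] [Algebra F K] {v : ι → Valuation K ℤᵐ⁰}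

open Polynomial in
/-- The functions whose only pole is `Q` separate two further places `P` and `P'`, if `P` is
rational. For an equation `∑ cₘ(f) zᵐ = 0` of a function `z` with a zero at `P` and a pole
at `P'`, with coefficients not all divisible by a function `f` that vanishes at `P` and `P'`, the
terms of the Horner scheme have `Q` as their only pole, and one of them is the function
sought. -/
theorem exists_separating (h : IsCurvePlaces F v) {Q P P' : ι} {f : K} (hfQ : 1 < v Q f)
    (hf : ∀ T, T ≠ Q → v T f ≤ 1) (hPQ : P ≠ Q) (hPQ' : P' ≠ Q) (hPP : P ≠ P')
    (hres : ∀ g, v P g ≤ 1 → ∃ c : F, v P (g - algebraMap F K c) < 1) :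
    ∃ g, (∀ T, T ≠ Q → v T g ≤ 1) ∧ v P g < 1 ∧ v P' g = 1 := by
  classical
  obtain ⟨c, hc⟩ := hres f (hf P hPQ)
  -- replace `f` by `f - c`
  set t := f - algebraMap F K c with ht
  have htQ : 1 < v Q t := by
    have : v Q (algebraMap F K c) < v Q f := (h.algebraMap_le Q c).trans_lt hfQ
    rwa [ht, (v Q).map_sub_eq_of_lt_left this]
  have htT : ∀ T, T ≠ Q → v T t ≤ 1 := fun T hT =>
    (v T).map_sub_le (hf T hT) (h.algebraMap_le T c)
  rcases (htT P' hPQ').lt_or_eq with htP' | htP'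
  swap
  · exact ⟨t, htT, hc, htP'⟩
  obtain ⟨z, hzP, hzP'⟩ := h.separated P P' hPP
  have htc := h.notMem_range_of_one_lt htQ
  have htt := h.transcendental htc
  have := h.finite t htt
  let _ : Algebra F[X] K := (aeval t).toAlgebra
  have hmap : ∀ q : F[X], algebraMap F[X] K q = aeval t q := fun q => rfl
  have hinj : Function.Injective (algebraMap F[X] K) := transcendental_iff_injective.mp htt
  have : FaithfulSMul F[X] K := (faithfulSMul_iff_algebraMap_injective F[X] K).mpr hinj
  have : Module.IsTorsionFree F[X] K := inferInstance
  obtain ⟨p, hp0, hpz⟩ : ∃ p : F[X][X], p ≠ 0 ∧ aeval z p = 0 := by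
    open scoped IntermediateField.algebraAdjoinAdjoin in
    have h1 : IsAlgebraic (Algebra.adjoin F {t}) z :=
      (IsFractionRing.isAlgebraic_iff (Algebra.adjoin F {t}) F⟮t⟯ K).mpr
        (Algebra.IsAlgebraic.isAlgebraic z)
    obtain ⟨q, hq0, hqz⟩ := h1
    have hsurj : Function.Surjective
        ((aeval t : F[X] →ₐ[F] K).codRestrict (Algebra.adjoin F {t})
          fun r => aeval_mem_adjoin_singleton F t) := by
      rintro ⟨a, ha⟩
      obtain ⟨r, hr⟩ := (Algebra.adjoin_singleton_eq_range_aeval F t).le ha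
      exact ⟨r, Subtype.ext hr⟩
    obtain ⟨p, hp⟩ := Polynomial.map_surjective _ hsurj q
    refine ⟨p, fun h0 => hq0 (by rw [← hp, h0, Polynomial.map_zero]), ?_⟩
    rw [← hp, aeval_def, eval₂_map] at hqz
    exact hqz
  let _ : NormalizedGCDMonoid F[X] := UniqueFactorizationMonoid.toNormalizedGCDMonoid F[X]
  have hpz := aeval_primPart_eq_zero hp0 hpz
  have hprim := p.isPrimitive_primPart
  set r := p.primPart
  obtain ⟨m, hm⟩ : ∃ m, (r.coeff m).coeff 0 ≠ 0 := by
    by_contra! hall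
    have : (C X : F[X][X]) ∣ r := by
      rw [C_dvd_iff_dvd_coeff]
      exact fun i => X_dvd_iff.mpr (hall i)
    exact not_isUnit_X (hprim X this)
  have hcoeff : ∀ T, T ≠ Q → ∀ q : F[X], v T (algebraMap F[X] K q) ≤ 1 := fun T hT q =>
    h.map_aeval_le T (htT T hT) q
  have hβ : ∀ T, T ≠ Q → ∀ k, v T (aeval z (divX^[k] r)) ≤ 1 := fun T hT k =>
    (v T).map_aeval_divX_iterate_le (hcoeff T hT) hpz k
  have hcm : ∀ k, (divX^[k] r).coeff 0 = r.coeff k := by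
    intro k
    have : ∀ j, (divX^[k] r).coeff j = r.coeff (j + k) := by
      induction k with
      | zero => simp
      | succ k ih =>
        intro j
        rw [Function.iterate_succ_apply', coeff_divX, ih, add_assoc, add_comm 1 k]
    simpa using this 0
  have hrec : ∀ k, z * aeval z (divX^[k + 1] r)
      = aeval z (divX^[k] r) - algebraMap F[X] K (r.coeff k) := by
    intro k
    rw [Function.iterate_succ_apply', ← hcm k]
    conv_rhs => rw [← divX_mul_X_add (divX^[k] r)]
    rw [map_add, map_mul, aeval_X, aeval_C]
    simp only [coeff_add, coeff_mul_X_zero, coeff_C_zero, zero_add]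
    ring
  have hreg : ∀ T, T ≠ Q → ∀ k, v T (z * aeval z (divX^[k + 1] r)) ≤ 1 := fun T hT k => by
    rw [hrec]
    exact (v T).map_sub_le (hβ T hT k) (hcoeff T hT _)
  -- the partial sums vanish at `P'`, where `z` has a pole
  have hβP' : ∀ k, v P' (aeval z (divX^[k] r)) < 1 := by
    intro k
    cases k with
    | zero => simp [hpz]
    | succ k =>
      by_contra! h1
      have h2 := hreg P' hPQ' k
      rw [map_mul] at h2
      exact absurd h2 (not_le.mpr (hzP'.trans_le (le_mul_of_one_le_right' h1)))
  have hcP' : v P' (algebraMap F[X] K (r.coeff m)) = 1 := by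
    rw [hmap, ← divX_mul_X_add (r.coeff m), map_add, map_mul, aeval_X, aeval_C]
    rw [(v P').map_add_eq_of_lt_right, h.map_algebraMap P' hm]
    rw [h.map_algebraMap P' hm, map_mul]
    exact (mul_le_of_le_one_left' (h.map_aeval_le P' htP'.le _)).trans_lt htP'
  refine ⟨z * aeval z (divX^[m + 1] r), fun T hT => hreg T hT m, ?_, ?_⟩
  · rw [map_mul]
    exact (mul_le_of_le_one_right' (hβ P hPQ _)).trans_lt hzP
  · rw [hrec, (v P').map_sub_eq_of_lt_right (by rw [hcP']; exact hβP' m), hcP']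

end IsCurvePlaces

end SinglePole

/-! ### Function fields of transcendence degree one -/

section Dimension

open IntermediateField

/-- A polynomial ring in at least two variables has a nonzero prime ideal that is not maximal. -/
lemma MvPolynomial.exists_isPrime_not_isMaximal (F : Type*) [Field F] {s : ℕ} (hs : 1 < s) :
    ∃ p : Ideal (MvPolynomial (Fin s) F), p ≠ ⊥ ∧ p.IsPrime ∧ ¬ p.IsMaximal := by
  let φ : MvPolynomial (Fin s) F →ₐ[F] Polynomial F :=
    MvPolynomial.aeval fun i => if i = ⟨1, hs⟩ then Polynomial.X else 0
  have hφ : Function.Surjective φ := by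
    rw [← AlgHom.range_eq_top, eq_top_iff, ← Polynomial.adjoin_X, Algebra.adjoin_le_iff,
      Set.singleton_subset_iff]
    exact ⟨MvPolynomial.X ⟨1, hs⟩, by simp [φ]⟩
  refine ⟨RingHom.ker φ, fun h0 => ?_, RingHom.ker_isPrime _, fun hmax => ?_⟩
  · have : (MvPolynomial.X ⟨0, by omega⟩ : MvPolynomial (Fin s) F) ∈ RingHom.ker φ := by
      rw [RingHom.mem_ker]
      simp [φ]
    rw [h0] at this
    exact MvPolynomial.X_ne_zero _ this
  · have h1 := (Ideal.Quotient.maximal_ideal_iff_isField_quotient _).mp hmax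
    exact Polynomial.not_isField F
      ((RingHom.quotientKerEquivOfSurjective (f := φ.toRingHom) hφ).symm.toMulEquiv.isField h1)

/-- The fraction field of a finitely generated domain of dimension at most one has transcendence
degree at most one, by Noether normalization and lying over. -/
lemma trdeg_le_one_of_dimensionLEOne (F A K : Type u) [Field F] [CommRing A] [IsDomain A]
    [Algebra F A] [Algebra.FiniteType F A] [Field K] [Algebra A K] [IsFractionRing A K]
    [Algebra F K] [IsScalarTower F A K] [Ring.DimensionLEOne A] : Algebra.trdeg F K ≤ 1 := by
  obtain ⟨s, g, hg, hgi⟩ := exists_integral_inj_algHom_of_fg F A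
  let _ : Algebra (MvPolynomial (Fin s) F) A := g.toRingHom.toAlgebra
  have : IsScalarTower F (MvPolynomial (Fin s) F) A := .of_algHom g
  have : Algebra.IsIntegral (MvPolynomial (Fin s) F) A := ⟨hgi⟩
  have hs : s ≤ 1 := by
    by_contra! hs
    obtain ⟨p, hp0, hpp, hpm⟩ := MvPolynomial.exists_isPrime_not_isMaximal F hs
    obtain ⟨P, -, hP, hPp⟩ := Ideal.exists_ideal_over_prime_of_isIntegral p (⊥ : Ideal A)
      (by
        intro x hx
        have : x = 0 := hg (by rw [map_zero]; exact hx)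
        rw [this]
        exact p.zero_mem)
    have hP0 : P ≠ ⊥ := by
      rintro rfl
      refine hp0 (eq_bot_iff.mpr fun x hx => ?_)
      rw [← hPp] at hx
      exact hg (by rw [map_zero]; exact hx)
    have : P.IsMaximal := Ring.DimensionLEOne.maximalOfPrime hP0 hP
    exact hpm (hPp ▸ Ideal.isMaximal_comap_of_isIntegral_of_isMaximal P)
  let _ : Algebra (MvPolynomial (Fin s) F) K :=
    ((algebraMap A K).comp (algebraMap (MvPolynomial (Fin s) F) A)).toAlgebra
  have : IsScalarTower (MvPolynomial (Fin s) F) A K := .of_algebraMap_eq fun _ => rfl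
  have : IsScalarTower F (MvPolynomial (Fin s) F) K := .of_algebraMap_eq fun c => by
    rw [IsScalarTower.algebraMap_apply F A K, IsScalarTower.algebraMap_apply F
      (MvPolynomial (Fin s) F) A]
    rfl
  have : FaithfulSMul (MvPolynomial (Fin s) F) K :=
    (faithfulSMul_iff_algebraMap_injective _ _).mpr ((IsFractionRing.injective A K).comp hg)
  have : Algebra.IsAlgebraic A K := IsLocalization.isAlgebraic _ (nonZeroDivisors A)
  have : Algebra.IsAlgebraic (MvPolynomial (Fin s) F) K := Algebra.IsAlgebraic.trans _ A _
  rw [← trdeg_add_eq F (MvPolynomial (Fin s) F) (A := K),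
    trdeg_eq_zero (R := MvPolynomial (Fin s) F) (A := K), add_zero,
    MvPolynomial.trdeg_of_isDomain]
  simpa using hs

lemma finiteDimensional_adjoin_of_dimensionLEOne (F A K : Type u) [Field F] [CommRing A]
    [IsDomain A] [Algebra F A] [Algebra.FiniteType F A] [Field K] [Algebra A K]
    [IsFractionRing A K] [Algebra F K] [IsScalarTower F A K] [Ring.DimensionLEOne A] {f : K}
    (hf : Transcendental F f) : FiniteDimensional F⟮f⟯ K := by
  have htr := trdeg_le_one_of_dimensionLEOne F A K
  have hind : AlgebraicIndependent F fun _ : Fin 1 => f :=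
    (algebraicIndependent_unique_type_iff (ι := Fin 1)).mpr hf
  have hbasis := hind.isTranscendenceBasis_of_lift_trdeg_le_of_finite (by simpa using htr)
  have halg := hbasis.isAlgebraic_field
  rw [Set.range_const] at halg
  have : Algebra.EssFiniteType A K := .of_isLocalization _ (nonZeroDivisors A)
  have : Algebra.EssFiniteType F K := .comp F A K
  have : Algebra.EssFiniteType F⟮f⟯ K := .of_comp F _ _
  exact Algebra.finite_of_essFiniteType_of_isAlgebraic

end Dimension

/-! ### The closed points of a curve as places -/

noncomputable section

namespace NonsingularProjectiveCurve

variable {F : Type u} [Field F] (C : NonsingularProjectiveCurve F)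

instance isProper_hom : IsProper C.hom := by
  obtain ⟨N, i, hi, h⟩ := C.projective
  let 𝒜 := MvPolynomial.homogeneousSubmodule (Fin (N + 1)) F
  have : IsScalarTower F (𝒜 0) (MvPolynomial (Fin (N + 1)) F) :=
    ⟨fun r x y => by
      rw [Algebra.smul_def, Algebra.smul_def (A := 𝒜 0), Algebra.smul_def, Algebra.smul_def,
        map_mul, mul_assoc]
      rfl⟩
  have : Algebra.FiniteType (𝒜 0) (MvPolynomial (Fin (N + 1)) F) :=
    Algebra.FiniteType.of_restrictScalars_finiteType F _ _
  have hs : Function.Surjective (algebraMap F (𝒜 0)) := by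
    rintro ⟨p, hp⟩
    have hp' : p ∈ (1 : Submodule F (MvPolynomial (Fin (N + 1)) F)) := by
      rw [← MvPolynomial.homogeneousSubmodule_zero]; exact hp
    obtain ⟨c, hc⟩ := Submodule.mem_one.mp hp'
    exact ⟨c, Subtype.ext hc⟩
  have : IsClosedImmersion (Spec.map (CommRingCat.ofHom (algebraMap F (𝒜 0)))) :=
    IsClosedImmersion.spec_of_surjective _ hs
  rw [← h]
  unfold projSpaceToSpec
  infer_instance

instance compactSpace : CompactSpace C.scheme :=
  (quasiCompact_iff_compactSpace C.hom).mp inferInstance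

open Order in
lemma coheight_le_one (x : C.scheme) : coheight x ≤ 1 := by
  have h := C.dim_eq_one
  let _ := specializationOrder C.scheme
  have h1 : krullDim C.scheme = 1 := by
    rw [← h]
    exact (krullDim_eq_of_orderIso (irreducibleSetEquivPoints (α := C.scheme))).symm
  have := coheight_le_krullDim x
  rw [h1] at this
  exact_mod_cast this

lemma genericPoint_ne (x : C.ClosedPoint) : genericPoint C.scheme ≠ x.1 := by
  intro h
  have hx : ∀ y, y = x.1 := fun y => by
    have h1 : y ∈ closure {genericPoint C.scheme} := by
      rw [genericPoint_closure]; trivial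
    rw [h, x.2.closure_eq] at h1
    exact h1
  have hsub : Subsingleton C.scheme := ⟨fun y z => (hx y).trans (hx z).symm⟩
  have := topologicalKrullDim_zero_of_discreteTopology C.scheme
  rw [C.dim_eq_one] at this
  exact absurd this (by norm_num)

open Order in
lemma coheight_eq_one (x : C.ClosedPoint) : coheight x.1 = 1 := by
  refine le_antisymm (C.coheight_le_one x.1) ?_
  rw [Order.one_le_iff_ne_zero, coheight_ne_zero]
  intro hmax
  have h1 : x.1 ≤ genericPoint C.scheme := genericPoint_specializes x.1
  exact C.genericPoint_ne x ((genericPoint_specializes x.1).antisymm (hmax h1)).eq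

instance isDiscreteValuationRing_stalk (x : C.ClosedPoint) :
    IsDiscreteValuationRing (C.stalk x.1) := by
  have := C.nonsingular x.1
  have hdim : ringKrullDim (C.stalk x.1) = 1 := by
    rw [ringKrullDim_stalk_eq_coheight, C.coheight_eq_one]
    rfl
  have h1 := (isRegularLocalRing_iff _).mp this
  rw [hdim] at h1
  have h2 : (IsLocalRing.maximalIdeal (C.stalk x.1)).spanFinrank = 1 := by exact_mod_cast h1
  have hfield : ¬ IsField (C.stalk x.1) := fun hf => by
    rw [ringKrullDim_eq_zero_of_isField hf] at hdim
    exact zero_ne_one hdim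
  exact ((IsDiscreteValuationRing.TFAE _ hfield).out 4 0).mp
    ((Submodule.spanFinrank_eq_one_iff _).mp h2).1

open WithZero

variable {C}

/-- The discrete valuation `exp (-v_x)` of the function field at a closed point `x`. -/
def ClosedPoint.valuation (x : C.ClosedPoint) : Valuation C.functionField ℤᵐ⁰ :=
  (IsDiscreteValuationRing.maximalIdeal (C.stalk x.1)).valuation C.functionField

lemma ClosedPoint.valuation_algebraMap_le (x : C.ClosedPoint) (a : C.stalk x.1) :
    x.valuation (algebraMap _ C.functionField a) ≤ 1 :=
  IsDedekindDomain.HeightOneSpectrum.valuation_le_one _ a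

lemma ClosedPoint.valuation_algebraMap_lt_iff (x : C.ClosedPoint) (a : C.stalk x.1) :
    x.valuation (algebraMap _ C.functionField a) < 1 ↔
      a ∈ IsLocalRing.maximalIdeal (C.stalk x.1) :=
  IsDedekindDomain.HeightOneSpectrum.valuation_lt_one_iff_mem _ a

lemma ClosedPoint.mem_localRing_iff (x : C.ClosedPoint) {f : C.functionField} :
    f ∈ C.localRing x.1 ↔ x.valuation f ≤ 1 := by
  constructor
  · rintro ⟨a, rfl⟩
    exact x.valuation_algebraMap_le a
  · intro h
    obtain ⟨a, rfl⟩ := IsDiscreteValuationRing.exists_lift_of_le_one h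
    exact ⟨a, rfl⟩

lemma ClosedPoint.ord_eq (x : C.ClosedPoint) {f : C.functionField} (hf : f ≠ 0) :
    Scheme.ord f x.1 = -log (x.valuation f) := by
  rw [Scheme.ord_eq_iff (C.coheight_eq_one x) hf]
  have h0 : x.valuation f ≠ 0 := (Valuation.ne_zero_iff _).mpr hf
  change Ring.ordFrac (C.stalk x.1) f = exp (-log (x.valuation f))
  rw [Ring.ordFrac_eq_valuation_inv, exp_neg, exp_log h0]
  rfl

lemma ClosedPoint.exists_valuation_eq_exp_one (x : C.ClosedPoint) :
    ∃ t, x.valuation t = exp 1 := by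
  obtain ⟨ϖ, hϖ⟩ := IsDiscreteValuationRing.exists_irreducible (C.stalk x.1)
  refine ⟨(algebraMap _ C.functionField ϖ)⁻¹, ?_⟩
  have := Ring.ordFrac_irreducible (K := C.functionField) hϖ
  rw [Ring.ordFrac_eq_valuation_inv] at this
  rw [map_inv₀]
  exact this

lemma ClosedPoint.valuation_algebraMap_field_le (x : C.ClosedPoint) (c : F) :
    x.valuation (algebraMap F C.functionField c) ≤ 1 :=
  x.mem_localRing_iff.mp (Subalgebra.algebraMap_mem _ c)

/-- The value of a function at a rational point is characterized by congruence modulo the maximal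
ideal. -/
lemma ClosedPoint.valuation_sub_eval_lt (x : C.ClosedPoint) (hx : x.IsRational)
    (f : C.localRing x.1) :
    x.valuation ((f : C.functionField) - algebraMap F C.functionField (x.eval hx f)) < 1 := by
  obtain ⟨_, a, rfl⟩ := f
  have h1 : (AlgEquiv.ofInjective (IsScalarTower.toAlgHom F (C.stalk x.1) C.functionField)
      (IsFractionRing.injective (C.stalk x.1) C.functionField)).symm ⟨_, a, rfl⟩ = a := by
    rw [AlgEquiv.symm_apply_eq]
    rfl
  have h2 : algebraMap F (IsLocalRing.ResidueField (C.stalk x.1)) (x.eval hx ⟨_, a, rfl⟩)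
      = IsLocalRing.residue _ a := by
    change AlgEquiv.ofBijective (Algebra.ofId F (IsLocalRing.ResidueField (C.stalk x.1))) hx
      ((AlgEquiv.ofBijective (Algebra.ofId F (IsLocalRing.ResidueField (C.stalk x.1))) hx).symm
        (IsLocalRing.residue _ ((AlgEquiv.ofInjective _
          (IsFractionRing.injective (C.stalk x.1) C.functionField)).symm ⟨_, a, rfl⟩))) = _
    rw [AlgEquiv.apply_symm_apply, h1]
  set c := x.eval hx ⟨_, a, rfl⟩
  change x.valuation (algebraMap (C.stalk x.1) C.functionField a
    - algebraMap F C.functionField c) < 1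
  rw [IsScalarTower.algebraMap_apply F (C.stalk x.1) C.functionField, ← map_sub,
    x.valuation_algebraMap_lt_iff, ← IsLocalRing.residue_eq_zero_iff, map_sub, sub_eq_zero, ← h2]
  rfl

/-- Since the curve is separated, a closed point is determined by its local ring. -/
lemma ClosedPoint.eq_of_localRing_le {x y : C.ClosedPoint}
    (h : C.localRing x.1 ≤ C.localRing y.1) : x = y := by
  have hex : ∀ a : C.stalk x.1, ∃ b : C.stalk y.1,
      algebraMap _ C.functionField b = algebraMap _ C.functionField a := fun a => h ⟨a, rfl⟩
  choose φ₀ hφ₀ using hex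
  have hinj := IsFractionRing.injective (C.stalk y.1) C.functionField
  let φ : C.stalk x.1 →+* C.stalk y.1 :=
    { toFun := φ₀
      map_one' := hinj (by rw [hφ₀, map_one, map_one])
      map_mul' := fun a b => hinj (by rw [hφ₀, map_mul, map_mul, hφ₀, hφ₀])
      map_zero' := hinj (by rw [hφ₀, map_zero, map_zero])
      map_add' := fun a b => hinj (by rw [hφ₀, map_add, map_add, hφ₀, hφ₀]) }
  have hgx := genericPoint_specializes x.1
  have hgy := genericPoint_specializes y.1
  have hcomp : CommRingCat.ofHom φ ≫ C.scheme.presheaf.stalkSpecializes hgy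
      = C.scheme.presheaf.stalkSpecializes hgx := by
    ext a
    exact hφ₀ a
  have hsep : C.scheme.IsSeparated := by
    rw [Scheme.isSeparated_iff, ← Limits.terminal.comp_from C.hom]
    infer_instance
  have hdom : IsDominant (Spec.map (C.scheme.presheaf.stalkSpecializes hgy)) := by
    constructor
    refine (PrimeSpectrum.denseRange_comap_iff_ker_le_nilRadical _).mpr ?_
    intro a ha
    have : a = 0 := hinj (by rw [map_zero]; exact ha)
    rw [this]
    exact Ideal.zero_mem _
  have heq : Spec.map (CommRingCat.ofHom φ) ≫ C.scheme.fromSpecStalk x.1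
      = C.scheme.fromSpecStalk y.1 := by
    refine ext_of_isDominant (Spec.map (C.scheme.presheaf.stalkSpecializes hgy)) ?_
    rw [← Category.assoc, ← Spec.map_comp, hcomp,
      Scheme.SpecMap_stalkSpecializes_fromSpecStalk, Scheme.SpecMap_stalkSpecializes_fromSpecStalk]
  have hmem : y.1 ∈ Set.range (C.scheme.fromSpecStalk x.1) := by
    have h1 := Scheme.fromSpecStalk_closedPoint (x := y.1)
    rw [← heq] at h1
    exact ⟨Spec.map (CommRingCat.ofHom φ) (IsLocalRing.closedPoint (C.stalk y.1)), h1⟩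
  rw [Scheme.range_fromSpecStalk] at hmem
  have h2 : x.1 ∈ closure {y.1} := specializes_iff_mem_closure.mp hmem
  rw [y.2.closure_eq] at h2
  exact Subtype.ext h2

lemma ClosedPoint.separated {x y : C.ClosedPoint} (hxy : x ≠ y) :
    ∃ z, x.valuation z < 1 ∧ 1 < y.valuation z := by
  obtain ⟨a, hax, hay⟩ : ∃ a ∈ C.localRing x.1, a ∉ C.localRing y.1 := by
    by_contra! h
    exact hxy (eq_of_localRing_le h)
  obtain ⟨b, hby, hbx⟩ : ∃ b ∈ C.localRing y.1, b ∉ C.localRing x.1 := by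
    by_contra! h
    exact hxy.symm (eq_of_localRing_le h)
  rw [mem_localRing_iff] at hax hay hby hbx
  rw [not_le] at hay hbx
  have hb0 : b ≠ 0 := fun h0 => by simp [h0] at hbx
  refine ⟨a / b, ?_, ?_⟩ <;> rw [map_div₀]
  · rw [div_lt_one₀ (zero_lt_one.trans hbx)]
    exact hax.trans_lt hbx
  · rw [one_lt_div₀ (zero_lt_iff.mpr ((Valuation.ne_zero_iff _).mpr hb0))]
    exact hby.trans_lt hay

variable (C) in
open TopologicalSpace Order in
/-- A closed set that does not contain the generic point contains only finitely many closed
points, which are its irreducible components. -/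
lemma finite_closedPoint_mem (Z : Closeds C.scheme) (hZ : genericPoint C.scheme ∉ Z) :
    {x : C.ClosedPoint | x.1 ∈ Z}.Finite := by
  have hnoeth : IsNoetherian C.scheme := {}
  obtain ⟨S, hSf, hS, rfl⟩ := NoetherianSpace.exists_finite_set_closeds_irreducible Z
  have hcover : ∀ x : C.ClosedPoint, x.1 ∈ sSup S → ∃ t ∈ S, (t : Set C.scheme) = {x.1} := by
    intro x hx
    lift S to Finset (Closeds C.scheme) using hSf
    rw [← Finset.sup_id_eq_sSup, ← SetLike.mem_coe, Closeds.coe_finset_sup] at hx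
    simp only [Finset.sup_set_eq_biUnion, Set.mem_iUnion] at hx
    obtain ⟨t, ht, hxt⟩ := hx
    have ht : t ∈ S := ht
    refine ⟨t, ht, ?_⟩
    have hirr := hS t ht
    obtain ⟨ξ, hξ⟩ := QuasiSober.sober hirr t.isClosed
    have hξx : ξ ⤳ x.1 := hξ.specializes hxt
    have hξη : genericPoint C.scheme ≠ ξ := by
      rintro h
      refine hZ ?_
      have h1 : t ≤ sSup (S : Set (Closeds C.scheme)) := le_sSup ht
      exact h1 (h ▸ hξ.mem)
    have hx1 : ξ = x.1 := by
      by_contra hne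
      have h1 : x.1 < ξ := lt_of_le_not_ge hξx fun h => hne (hξx.antisymm h).eq
      have h2 : ξ < genericPoint C.scheme := lt_of_le_not_ge (genericPoint_specializes ξ)
        fun h => hξη ((genericPoint_specializes ξ).antisymm h).eq
      have h3 := coheight_add_one_le h1
      have h4 := coheight_add_one_le h2
      rw [C.coheight_eq_one x] at h3
      have h5 : coheight ξ = 0 := by
        have : coheight ξ + 1 ≤ 0 + 1 := h3
        exact nonpos_iff_eq_zero.mp ((ENat.add_le_add_iff_right (by simp)).mp this)
      rw [h5] at h4
      simp at h4
    rw [← hξ.def, hx1, x.2.closure_eq]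
  choose! g hg hg' using hcover
  refine Set.Finite.of_injOn (f := g) (fun x hx => hg x hx) (fun x hx y hy hxy => ?_) hSf
  have := hg' x hx
  rw [hxy, hg' y hy] at this
  exact Subtype.ext (Set.singleton_injective this).symm

lemma finite_poles (f : C.functionField) :
    {x : C.ClosedPoint | 1 < x.valuation f}.Finite := by
  obtain ⟨U, hU, s, hs⟩ := C.scheme.presheaf.exists_germ_eq f
  refine (C.finite_closedPoint_mem (TopologicalSpace.Closeds.mk Uᶜ U.isOpen.isClosed_compl)
    (fun h => h hU)).subset fun x hx hxU => ?_
  refine absurd (show 1 < x.valuation f from hx) (not_lt.mpr ?_)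
  rw [← hs, ← x.mem_localRing_iff]
  refine ⟨C.scheme.presheaf.germ U x.1 hxU s, ?_⟩
  exact C.scheme.presheaf.germ_stalkSpecializes_apply hxU (genericPoint_specializes x.1) s

/-! ### Global sections and the function field -/

open TopologicalSpace

/-- An open set that contains all closed points is the whole curve. -/
lemma eq_top_of_forall_closedPoint (U : C.scheme.Opens) (h : ∀ x : C.ClosedPoint, x.1 ∈ U) :
    U = ⊤ := by
  by_contra hU
  have hne : (U : Set C.scheme)ᶜ.Nonempty := by
    rw [Set.nonempty_compl]
    exact fun h1 => hU (Opens.ext h1)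
  obtain ⟨x, hx, hxc⟩ := U.isOpen.isClosed_compl.exists_closed_singleton hne
  exact hx (h ⟨x, hxc⟩)

/-- A function that is regular at all closed points is a global section. -/
lemma exists_section_of_forall_regular {f : C.functionField}
    (hf : ∀ x : C.ClosedPoint, f ∈ C.localRing x.1) :
    ∃ s : Γ(C.scheme, ⊤), C.scheme.presheaf.germ ⊤ (genericPoint C.scheme) trivial s = f := by
  have hex : ∀ x : C.ClosedPoint, ∃ (U : C.scheme.Opens) (_ : x.1 ∈ U)
      (hη : genericPoint C.scheme ∈ U) (t : Γ(C.scheme, U)),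
      C.scheme.presheaf.germ U (genericPoint C.scheme) hη t = f := by
    intro x
    obtain ⟨a, ha⟩ := hf x
    obtain ⟨U, hU, t, rfl⟩ := C.scheme.presheaf.exists_germ_eq a
    have hη := (genericPoint_specializes x.1).mem_open U.isOpen hU
    refine ⟨U, hU, hη, t, ?_⟩
    rw [← ha]
    exact (C.scheme.presheaf.germ_stalkSpecializes_apply hU (genericPoint_specializes x.1) t).symm
  choose U hU hη t ht using hex
  obtain ⟨s, hs, -⟩ := C.scheme.sheaf.existsUnique_gluing' U ⊤ (fun x => homOfLE le_top)
    (eq_top_of_forall_closedPoint _ fun x => Opens.mem_iSup.mpr ⟨x, hU x⟩).ge t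
    (fun x y => by
      refine germ_injective_of_isIntegral C.scheme (genericPoint C.scheme)
        (U := U x ⊓ U y) ⟨hη x, hη y⟩ ?_
      erw [C.scheme.presheaf.germ_res_apply, C.scheme.presheaf.germ_res_apply]
      rw [ht, ht])
  have hne : Nonempty C.ClosedPoint := by
    by_contra hne
    rw [not_nonempty_iff] at hne
    have := eq_top_of_forall_closedPoint (⊥ : C.scheme.Opens) fun x => hne.elim x
    have h1 : genericPoint C.scheme ∈ (⊥ : C.scheme.Opens) := this ▸ trivial
    exact h1
  obtain ⟨x⟩ := hne
  refine ⟨s, ?_⟩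
  rw [← ht x, ← hs x]
  exact (C.scheme.presheaf.germ_res_apply (homOfLE le_top) (genericPoint C.scheme) (hη x) s).symm

/-- The functions without poles are the constants, if there is a rational point `Q`: the global
sections form a field, so a section that vanishes at `Q` is zero. -/
lemma mem_range_algebraMap_of_forall_le {Q : C.ClosedPoint} (hQ : Q.IsRational)
    {f : C.functionField} (hf : ∀ x : C.ClosedPoint, x.valuation f ≤ 1) :
    f ∈ Set.range (algebraMap F C.functionField) := by
  let c := Q.eval hQ ⟨f, Q.mem_localRing_iff.mpr (hf Q)⟩
  have hlt : Q.valuation (f - algebraMap F C.functionField c) < 1 :=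
    Q.valuation_sub_eval_lt hQ ⟨f, Q.mem_localRing_iff.mpr (hf Q)⟩
  refine ⟨c, (sub_eq_zero.mp ?_).symm⟩
  by_contra hne
  obtain ⟨s, hs⟩ := exists_section_of_forall_regular
    (f := f - algebraMap F C.functionField c) fun x => x.mem_localRing_iff.mpr
      ((Valuation.map_sub_le _ (hf x) (x.valuation_algebraMap_field_le c)))
  have hs0 : s ≠ 0 := fun h0 => hne (by rw [← hs, h0, map_zero])
  obtain ⟨s', hs'⟩ := (isField_of_universallyClosed F C.hom).mul_inv_cancel hs0
  have hgerm : algebraMap (C.stalk Q.1) C.functionField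
      (C.scheme.presheaf.germ ⊤ Q.1 trivial s) = f - algebraMap F C.functionField c := by
    rw [← hs]
    exact C.scheme.presheaf.germ_stalkSpecializes_apply (U := ⊤) trivial
      (genericPoint_specializes Q.1) s
  rw [← hgerm, Q.valuation_algebraMap_lt_iff, IsLocalRing.mem_maximalIdeal] at hlt
  exact hlt ((IsUnit.of_mul_eq_one s' hs').map (C.scheme.presheaf.germ ⊤ Q.1 trivial).hom)

variable (C) in
lemma finiteDimensional_adjoin {f : C.functionField} (hf : Transcendental F f) :
    FiniteDimensional (IntermediateField.adjoin F {f}) C.functionField := by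
  obtain ⟨_, ⟨U, hU, rfl⟩, hxU, -⟩ := C.scheme.isBasis_affineOpens.exists_subset_of_mem_open
    (Set.mem_univ (genericPoint C.scheme)) isOpen_univ
  have : Nonempty U := ⟨⟨_, hxU⟩⟩
  let A := Γ(C.scheme, U)
  have hfrac : IsFractionRing A C.functionField :=
    functionField_isFractionRing_of_isAffineOpen _ U hU
  let ψ : CommRingCat.of F ⟶ Γ(C.scheme, U) :=
    (Scheme.ΓSpecIso (.of F)).inv ≫ C.hom.appLE ⊤ U le_top
  let _ : Algebra F A := ψ.hom.toAlgebra
  have htower : IsScalarTower F A C.functionField := by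
    refine .of_algebraMap_eq fun c => ?_
    change C.scheme.presheaf.germ ⊤ (genericPoint C.scheme) trivial (C.hom.appTop _) =
      C.scheme.presheaf.germ U (genericPoint C.scheme) hxU
        (C.scheme.presheaf.map (homOfLE le_top).op (C.hom.appTop _))
    exact (C.scheme.presheaf.germ_res_apply (homOfLE le_top) (genericPoint C.scheme) hxU _).symm
  have hfin : Algebra.FiniteType F A := by
    have h1 := C.hom.finiteType_appLE (isAffineOpen_top _) hU le_top
    have h2 : ψ.hom.FiniteType := h1.comp
      (.of_surjective (Scheme.ΓSpecIso (.of F)).inv.hom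
        (ConcreteCategory.bijective_of_isIso (Scheme.ΓSpecIso (.of F)).inv).2)
    exact h2
  have hdim : Ring.DimensionLEOne A := by
    have h1 : ringKrullDim A ≤ 1 := by
      rw [← PrimeSpectrum.topologicalKrullDim_eq_ringKrullDim, ← C.dim_eq_one]
      have := hU.isOpenImmersion_fromSpec
      exact hU.fromSpec.isOpenEmbedding.isInducing.topologicalKrullDim_le
    have : Ring.KrullDimLE 1 A := Ring.krullDimLE_iff.mpr h1
    exact ⟨fun hp0 hp => hp.isMaximal_of_ne_bot hp0⟩
  exact finiteDimensional_adjoin_of_dimensionLEOne F A C.functionField hf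

/-- The closed points of a curve with a rational point are the places of its function field. -/
theorem isCurvePlaces {Q : C.ClosedPoint} (hQ : Q.IsRational) :
    IsCurvePlaces F fun x : C.ClosedPoint => x.valuation where
  algebraMap_le x c := x.valuation_algebraMap_field_le c
  separated _ _ h := ClosedPoint.separated h
  finite_poles f := finite_poles f
  const _ hf := mem_range_algebraMap_of_forall_le hQ hf
  finite _ hf := C.finiteDimensional_adjoin hf

end NonsingularProjectiveCurve
end

/-! ### Pole orders as near weights -/

/-- An algebra homomorphism to `Fⁿ` is surjective if its image separates the coordinates. -/
lemma AlgHom.surjective_of_separating {F R ι : Type*} [Field F] [CommRing R] [Algebra F R]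
    [Fintype ι] (φ : R →ₐ[F] (ι → F)) (h : ∀ i j, i ≠ j → ∃ r, φ r i = 0 ∧ φ r j ≠ 0) :
    Function.Surjective φ := by
  classical
  choose! r h0 h1 using h
  let e : ι → R := fun j => ∏ i ∈ Finset.univ.erase j, r i j
  have he0 : ∀ i j, i ≠ j → φ (e j) i = 0 := fun i j hij => by
    simp only [e, map_prod, Finset.prod_apply]
    exact Finset.prod_eq_zero (Finset.mem_erase.mpr ⟨hij, Finset.mem_univ i⟩) (h0 i j hij)
  have he1 : ∀ j, φ (e j) j ≠ 0 := fun j => by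
    simp only [e, map_prod, Finset.prod_apply]
    exact Finset.prod_ne_zero_iff.mpr fun i hi => h1 i j (Finset.ne_of_mem_erase hi)
  intro y
  refine ⟨∑ j, (y j / φ (e j) j) • e j, ?_⟩
  ext i
  simp only [map_sum, map_smul, Finset.sum_apply, Pi.smul_apply, smul_eq_mul]
  rw [Finset.sum_eq_single i (fun j _ hj => by rw [he0 i j hj.symm, mul_zero]) (by simp),
    div_mul_cancel₀ _ (he1 i)]

noncomputable section

namespace NonsingularProjectiveCurve

open WithZero

variable {F : Type u} [Field F] {C : NonsingularProjectiveCurve F}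

lemma poleOrder_zero (x : C.ClosedPoint) : poleOrder x 0 = ⊥ := if_pos rfl

lemma poleOrder_eq (x : C.ClosedPoint) {f : C.functionField} (hf : f ≠ 0) :
    poleOrder x f = ((log (x.valuation f)).toNat : WithBot ℕ) := by
  rw [poleOrder, if_neg hf, x.ord_eq hf, neg_neg]

lemma poleOrder_le_iff (x : C.ClosedPoint) {f : C.functionField} {n : ℕ} :
    poleOrder x f ≤ n ↔ x.valuation f ≤ exp (n : ℤ) := by
  by_cases hf : f = 0
  · simp [hf, poleOrder_zero]
  rw [poleOrder_eq x hf, Nat.cast_withBot, Nat.cast_withBot, WithBot.coe_le_coe,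
    ← log_le_iff_le_exp ((Valuation.ne_zero_iff _).mpr hf)]
  omega

lemma poleOrder_lt_iff (x : C.ClosedPoint) {f : C.functionField} {n : ℕ} (hn : 0 < n) :
    poleOrder x f < n ↔ x.valuation f < exp (n : ℤ) := by
  by_cases hf : f = 0
  · simp [hf, poleOrder_zero, exp_pos, Nat.cast_withBot]
  rw [poleOrder_eq x hf, Nat.cast_withBot, Nat.cast_withBot, WithBot.coe_lt_coe,
    ← log_lt_iff_lt_exp ((Valuation.ne_zero_iff _).mpr hf)]
  omega

lemma poleOrder_mul (x : C.ClosedPoint) {f g : C.functionField} (hf : f ≠ 0) (hg : g ≠ 0) :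
    poleOrder x (f * g) =
      ((log (x.valuation f) + log (x.valuation g)).toNat : WithBot ℕ) := by
  rw [poleOrder_eq x (mul_ne_zero hf hg), map_mul, log_mul ((Valuation.ne_zero_iff _).mpr hf)
    ((Valuation.ne_zero_iff _).mpr hg)]

lemma poleOrder_one (x : C.ClosedPoint) : poleOrder x (1 : C.functionField) = (0 : ℕ) := by
  rw [poleOrder_eq x one_ne_zero, map_one, log_one]
  rfl

lemma mem_nearU_poleOrder (x : C.ClosedPoint) {R : Subalgebra F C.functionField} {f : R} :
    f ∈ NearU (fun f : R => poleOrder x (f : C.functionField)) ↔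
      x.valuation (f : C.functionField) ≤ 1 := by
  change poleOrder x (f : C.functionField) ≤ poleOrder x (1 : C.functionField) ↔ _
  rw [poleOrder_one, poleOrder_le_iff]
  rfl

lemma mem_nearM_poleOrder (x : C.ClosedPoint) {R : Subalgebra F C.functionField} {f : R} :
    f ∈ NearM (fun f : R => poleOrder x (f : C.functionField)) ↔
      1 < x.valuation (f : C.functionField) := by
  change poleOrder x (1 : C.functionField) < poleOrder x (f : C.functionField) ↔ _
  rw [poleOrder_one, ← not_le, poleOrder_le_iff, not_le]
  rfl

/-- At a rational point `x`, the pole order is a near weight on every algebra of functions. -/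
lemma isNearWeight_poleOrder {x : C.ClosedPoint} (hx : x.IsRational)
    (R : Subalgebra F C.functionField) :
    IsNearWeight F fun f : R => poleOrder x (f : C.functionField) where
  eq_bot_iff f := by
    by_cases hf : (f : C.functionField) = 0
    · exact iff_of_true (by rw [hf, poleOrder_zero]) (Subtype.ext hf)
    · rw [poleOrder_eq x hf]
      simpa [Nat.cast_withBot] using hf
  smul c f hc := by
    have h1 : x.valuation (algebraMap F C.functionField c) = 1 :=
      (isCurvePlaces hx).map_algebraMap x hc
    have hc' : algebraMap F C.functionField c ≠ 0 := by simpa using hc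
    change poleOrder x (c • (f : C.functionField)) = _
    by_cases hf : (f : C.functionField) = 0
    · rw [hf, smul_zero]
    · rw [Algebra.smul_def, poleOrder_mul x hc' hf, poleOrder_eq x hf, h1, log_one, zero_add]
  add_le f g := by
    change poleOrder x ((f : C.functionField) + g) ≤ _
    by_cases hf : (f : C.functionField) = 0
    · simp [hf]
    by_cases hg : (g : C.functionField) = 0
    · simp [hg]
    rcases le_total (x.valuation (f : C.functionField)) (x.valuation (g : C.functionField))
      with hle | hle
    · refine le_max_of_le_right ?_
      rw [poleOrder_eq x hg, poleOrder_le_iff]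
      refine (x.valuation.map_add_le hle le_rfl).trans ?_
      rw [← log_le_iff_le_exp ((Valuation.ne_zero_iff _).mpr hg)]
      exact Int.self_le_toNat _
    · refine le_max_of_le_left ?_
      rw [poleOrder_eq x hf, poleOrder_le_iff]
      refine (x.valuation.map_add_le le_rfl hle).trans ?_
      rw [← log_le_iff_le_exp ((Valuation.ne_zero_iff _).mpr hf)]
      exact Int.self_le_toNat _
  mul_le_mul f g h hfg := by
    change poleOrder x ((f : C.functionField) * h) ≤ poleOrder x ((g : C.functionField) * h)
    by_cases hf : (f : C.functionField) = 0
    · simp [hf, poleOrder_zero]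
    by_cases hg : (g : C.functionField) = 0
    · simp [hg, poleOrder_zero] at hfg
    by_cases hh : (h : C.functionField) = 0
    · simp [hh]
    simp only [poleOrder_eq x hf, poleOrder_eq x hg, Nat.cast_withBot, WithBot.coe_lt_coe] at hfg
    rw [poleOrder_mul x hf hh, poleOrder_mul x hg hh, Nat.cast_withBot, Nat.cast_withBot,
      WithBot.coe_le_coe]
    omega
  mul_lt_mul f g h hfg hM := by
    rw [mem_nearM_poleOrder] at hM
    have hh : (h : C.functionField) ≠ 0 := fun h0 => by simp [h0] at hM
    rw [← log_lt_log one_ne_zero ((Valuation.ne_zero_iff _).mpr hh), log_one] at hM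
    change poleOrder x ((f : C.functionField) * h) < poleOrder x ((g : C.functionField) * h)
    by_cases hg : (g : C.functionField) = 0
    · simp [hg, poleOrder_zero] at hfg
    by_cases hf : (f : C.functionField) = 0
    · rw [hf, zero_mul, poleOrder_zero, poleOrder_mul x hg hh]
      exact WithBot.bot_lt_coe _
    simp only [poleOrder_eq x hf, poleOrder_eq x hg, Nat.cast_withBot, WithBot.coe_lt_coe] at hfg
    rw [poleOrder_mul x hf hh, poleOrder_mul x hg hh, Nat.cast_withBot, Nat.cast_withBot,
      WithBot.coe_lt_coe]
    omega
  exists_sub_lt f g hfg hfM hgM := by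
    rw [mem_nearM_poleOrder] at hfM hgM
    have hf : (f : C.functionField) ≠ 0 := fun h0 => by simp [h0] at hfM
    have hg : (g : C.functionField) ≠ 0 := fun h0 => by simp [h0] at hgM
    have hvf := (Valuation.ne_zero_iff x.valuation).mpr hf
    have hvg := (Valuation.ne_zero_iff x.valuation).mpr hg
    rw [← log_lt_log one_ne_zero hvf, log_one] at hfM
    rw [← log_lt_log one_ne_zero hvg, log_one] at hgM
    simp only [poleOrder_eq x hf, poleOrder_eq x hg, Nat.cast_withBot, WithBot.coe_inj] at hfg
    have hlog : log (x.valuation (f : C.functionField)) =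
        log (x.valuation (g : C.functionField)) := by
      omega
    have hv : x.valuation (f : C.functionField) = x.valuation (g : C.functionField) := by
      rw [← exp_log hvf, hlog, exp_log hvg]
    -- the leading coefficient `c` is the value of `f / g` at `x`
    have hu : x.valuation ((f : C.functionField) / g) = 1 := by
      rw [map_div₀, hv, div_self hvg]
    let u : C.localRing x.1 := ⟨(f : C.functionField) / g, x.mem_localRing_iff.mpr hu.le⟩
    have hc := x.valuation_sub_eval_lt hx u
    set c := x.eval hx u
    refine ⟨c, fun h0 => ?_, ?_⟩
    · rw [h0, map_zero, sub_zero] at hc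
      exact hc.ne hu
    · change poleOrder x ((f : C.functionField) - c • (g : C.functionField)) < poleOrder x _
      rw [poleOrder_eq x hf, poleOrder_lt_iff x (by omega), Int.toNat_of_nonneg hfM.le,
        exp_log hvf, hv]
      have h1 : (f : C.functionField) - c • (g : C.functionField)
          = ((f : C.functionField) / g - algebraMap F C.functionField c) * g := by
        rw [sub_mul, div_mul_cancel₀ _ hg, Algebra.smul_def]
      rw [h1, map_mul]
      exact mul_lt_of_lt_one_left (zero_lt_iff.mpr hvg) hc
  mul_le f g := by
    change poleOrder x ((f : C.functionField) * g) ≤ _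
    by_cases hf : (f : C.functionField) = 0
    · simp [hf, poleOrder_zero]
    by_cases hg : (g : C.functionField) = 0
    · simp [hg, poleOrder_zero]
    rw [poleOrder_mul x hf hg, poleOrder_eq x hf, poleOrder_eq x hg, Nat.cast_withBot,
      Nat.cast_withBot, Nat.cast_withBot, ← WithBot.coe_add, WithBot.coe_le_coe]
    omega
  mul_eq f g hfM hgM := by
    rw [mem_nearM_poleOrder] at hfM hgM
    have hf : (f : C.functionField) ≠ 0 := fun h0 => by simp [h0] at hfM
    have hg : (g : C.functionField) ≠ 0 := fun h0 => by simp [h0] at hgM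
    rw [← log_lt_log one_ne_zero ((Valuation.ne_zero_iff _).mpr hf), log_one] at hfM
    rw [← log_lt_log one_ne_zero ((Valuation.ne_zero_iff _).mpr hg), log_one] at hgM
    change poleOrder x ((f : C.functionField) * g) = _
    rw [poleOrder_mul x hf hg, poleOrder_eq x hf, poleOrder_eq x hg, Nat.cast_withBot,
      Nat.cast_withBot, Nat.cast_withBot, ← WithBot.coe_add, WithBot.coe_inj]
    omega

lemma isNormalizedNear_poleOrder (x : C.ClosedPoint) (R : Subalgebra F C.functionField) :
    IsNormalizedNear fun f : R => poleOrder x (f : C.functionField) := by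
  refine ⟨poleOrder_zero x, fun f hf hf0 => ?_⟩
  have hf0 : (f : C.functionField) ≠ 0 := by simpa using hf0
  rw [mem_nearU_poleOrder, ← log_le_log ((Valuation.ne_zero_iff _).mpr hf0) one_ne_zero,
    log_one] at hf
  change poleOrder x (f : C.functionField) = 0
  rw [poleOrder_eq x hf0, Int.toNat_of_nonpos hf]
  rfl

lemma mem_regularAway_iff {m : ℕ} {Q : Fin m → C.ClosedPoint} {f : C.functionField} :
    f ∈ regularAway Q ↔ ∀ x, x ∉ Set.range Q → x.valuation f ≤ 1 := by
  rw [regularAway, Algebra.mem_iInf, Subtype.forall]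
  exact forall₂_congr fun x _ => x.mem_localRing_iff

lemma mem_regularAway_of_forall_ne {m : ℕ} {Q : Fin m → C.ClosedPoint} (k : Fin m)
    {f : C.functionField} (hf : ∀ x, x ≠ Q k → x.valuation f ≤ 1) : f ∈ regularAway Q :=
  mem_regularAway_iff.mpr fun x hx => hf x fun h => hx ⟨k, h.symm⟩

theorem isCompleteSetOfNearWeights_poleOrder {m : ℕ} (hm : 1 ≤ m) (Q : Fin m → C.ClosedPoint)
    (hQ : Function.Injective Q) (hQr : ∀ k, (Q k).IsRational) :
    IsCompleteSetOfNearWeights F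
      fun (k : Fin m) (f : regularAway Q) => poleOrder (Q k) (f : C.functionField) := by
  have hplaces := isCurvePlaces (hQr ⟨0, hm⟩)
  have hpole : ∀ k, ∃ d₀ : ℕ, ∀ d ≥ d₀, ∃ f : regularAway Q,
      (Q k).valuation (f : C.functionField) = exp (d : ℤ) ∧
        ∀ x, x ≠ Q k → x.valuation (f : C.functionField) ≤ 1 := fun k => by
    obtain ⟨t, ht⟩ := (Q k).exists_valuation_eq_exp_one
    obtain ⟨d₀, hd₀⟩ := hplaces.exists_pole_order ht
    refine ⟨d₀, fun d hd => ?_⟩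
    obtain ⟨f, hfQ, hf⟩ := hd₀ d hd
    exact ⟨⟨f, mem_regularAway_of_forall_ne k hf⟩, hfQ, hf⟩
  refine ⟨fun k => isNearWeight_poleOrder (hQr k) _, fun k => ?_,
    fun k => isNormalizedNear_poleOrder (Q k) _, ?_, fun k => ?_⟩
  · obtain ⟨d₀, hd₀⟩ := hpole k
    obtain ⟨f, hf, -⟩ := hd₀ (d₀ + 1) (by omega)
    refine ⟨f, (mem_nearM_poleOrder (Q k)).mpr ?_⟩
    rw [hf, ← exp_zero, exp_lt_exp]
    omega
  · ext f
    simp only [Set.mem_iInter, mem_nearU_poleOrder]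
    constructor
    · intro hf
      obtain ⟨c, hc⟩ := hplaces.const (f : C.functionField) fun x => by
        by_cases hx : x ∈ Set.range Q
        · obtain ⟨k, rfl⟩ := hx
          exact hf k
        · exact mem_regularAway_iff.mp f.2 x hx
      exact ⟨c, Subtype.ext hc⟩
    · rintro ⟨c, rfl⟩ k
      exact (Q k).valuation_algebraMap_field_le c
  · obtain ⟨d₀, hd₀⟩ := hpole k
    refine (Set.finite_lt_nat d₀).subset fun d hd => ?_
    by_contra hlt
    obtain ⟨f, hfQ, hf⟩ := hd₀ d (not_lt.mp hlt)
    refine hd ⟨f, ?_, ?_⟩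
    · simp only [Set.mem_iInter, mem_nearU_poleOrder]
      exact fun i hi => hf _ (hQ.ne hi)
    · have hf0 : (f : C.functionField) ≠ 0 := fun h0 => by
        rw [h0, map_zero] at hfQ
        exact exp_ne_zero hfQ.symm
      change poleOrder (Q k) (f : C.functionField) = _
      rw [poleOrder_eq _ hf0, hfQ, log_exp, Int.toNat_natCast]

lemma ClosedPoint.eval_eq_zero_iff (x : C.ClosedPoint) (hx : x.IsRational)
    (f : C.localRing x.1) : x.eval hx f = 0 ↔ x.valuation (f : C.functionField) < 1 := by
  have h := x.valuation_sub_eval_lt hx f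
  constructor
  · intro h0
    rwa [h0, map_zero, sub_zero] at h
  · intro hf
    by_contra hne
    have h1 := (isCurvePlaces hx).map_algebraMap x hne
    have h2 : algebraMap F C.functionField (x.eval hx f)
        = f - (f - algebraMap F C.functionField (x.eval hx f)) := by ring
    rw [h2] at h1
    exact (x.valuation.map_sub_lt hf h).ne h1

theorem evalMap_surjective {m n : ℕ} (hm : 1 ≤ m) (Q : Fin m → C.ClosedPoint)
    (hQr : ∀ k, (Q k).IsRational) (P : Fin n → C.ClosedPoint) (hP : Function.Injective P)
    (hPr : ∀ i, (P i).IsRational) (hPQ : ∀ i k, P i ≠ Q k) :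
    Function.Surjective (evalMap Q P hPr hPQ) := by
  let k : Fin m := ⟨0, hm⟩
  have hplaces := isCurvePlaces (hQr k)
  obtain ⟨t, ht⟩ := (Q k).exists_valuation_eq_exp_one
  obtain ⟨f, hfQ, hf⟩ := hplaces.exists_single_pole (Q := Q k) (x := t)
    (by rw [ht, ← exp_zero, exp_lt_exp]; exact one_pos)
  refine AlgHom.surjective_of_separating _ fun i j hij => ?_
  obtain ⟨g, hg, hgi, hgj⟩ := hplaces.exists_separating hfQ hf (hPQ i k) (hPQ j k) (hP.ne hij)
    fun g hg => ⟨_, (P i).valuation_sub_eval_lt (hPr i) ⟨g, (P i).mem_localRing_iff.mpr hg⟩⟩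
  refine ⟨⟨g, mem_regularAway_of_forall_ne k hg⟩, ?_, fun h0 => ?_⟩
  · exact ((P i).eval_eq_zero_iff (hPr i) ⟨g, _⟩).mpr hgi
  · exact (((P j).eval_eq_zero_iff (hPr j) ⟨g, _⟩).mp h0).ne hgj

/-- The Riemann–Roch space of `∑ aₖ Qₖ` consists of the functions regular away from the `Qₖ` whose
pole orders at the `Qₖ` are at most the `aₖ`. -/
lemma mem_riemannRochSpace_iff {m : ℕ} {Q : Fin m → C.ClosedPoint} (hQ : Function.Injective Q)
    (a : Fin m → ℕ) {h : C.functionField} :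
    h ∈ riemannRochSpace (∑ k, Finsupp.single (Q k) (a k : ℤ)) ↔
      h ∈ regularAway Q ∧ ∀ k, poleOrder (Q k) h ≤ (a k : WithBot ℕ) := by
  classical
  have hG : ∀ k, (∑ k, Finsupp.single (Q k) (a k : ℤ)) (Q k) = a k := fun k => by
    rw [Finsupp.finsetSum_apply, Finset.sum_eq_single k]
    · exact Finsupp.single_eq_same
    · exact fun i _ hi => Finsupp.single_eq_of_ne (hQ.ne hi).symm
    · simp
  have hG0 : ∀ x, x ∉ Set.range Q → (∑ k, Finsupp.single (Q k) (a k : ℤ)) x = 0 := fun x hx => by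
    rw [Finsupp.finsetSum_apply]
    exact Finset.sum_eq_zero fun i _ => Finsupp.single_eq_of_ne fun h => hx ⟨i, h.symm⟩
  by_cases h0 : h = 0
  · refine iff_of_true (fun hne => absurd h0 hne) ⟨h0 ▸ zero_mem _, fun k => ?_⟩
    rw [h0, poleOrder_zero]
    exact bot_le
  have hkey : ∀ (x : C.ClosedPoint) (n : ℤ),
      0 ≤ Scheme.ord h x.1 + n ↔ x.valuation h ≤ exp n := fun x n => by
    rw [x.ord_eq h0, ← log_le_iff_le_exp ((Valuation.ne_zero_iff _).mpr h0)]
    omega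
  simp only [riemannRochSpace, Set.mem_ofPred_eq, hkey, mem_regularAway_iff, poleOrder_le_iff]
  constructor
  · intro hL
    refine ⟨fun x hx => ?_, fun k => ?_⟩
    · have := hL h0 x
      rwa [hG0 x hx, exp_zero] at this
    · have := hL h0 (Q k)
      rwa [hG k] at this
  · rintro ⟨hreg, hQk⟩ - x
    by_cases hx : x ∈ Set.range Q
    · obtain ⟨k, rfl⟩ := hx
      rw [hG k]
      exact hQk k
    · rw [hG0 x hx, exp_zero]
      exact hreg x hx

end NonsingularProjectiveCurve

end

theorem mainTheorem3 {F : Type*} [Field F] [Finite F] (C : NonsingularProjectiveCurve F)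
    {m n : ℕ} (hm : 1 ≤ m)
    (Q : Fin m → C.ClosedPoint) (hQ : Function.Injective Q) (hQr : ∀ k, (Q k).IsRational)
    (P : Fin n → C.ClosedPoint) (hP : Function.Injective P) (hPr : ∀ i, (P i).IsRational)
    (hPQ : ∀ i k, P i ≠ Q k) (a : Fin m → ℕ) :
    let R : Subalgebra F C.functionField := NonsingularProjectiveCurve.regularAway Q
    let φ : R →ₐ[F] (Fin n → F) := NonsingularProjectiveCurve.evalMap Q P hPr hPQ
    let ρ : Fin m → R → WithBot ℕ :=
      fun k f => NonsingularProjectiveCurve.poleOrder (Q k) (f : C.functionField)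
    let G : C.Divisor := ∑ k, Finsupp.single (Q k) (a k : ℤ)
    IsCompleteSetOfNearWeights F ρ ∧
      Function.Surjective φ ∧
      NonsingularProjectiveCurve.goppaCode P hPr G = evaluationCode ρ φ a := by
  refine ⟨NonsingularProjectiveCurve.isCompleteSetOfNearWeights_poleOrder hm Q hQ hQr,
    NonsingularProjectiveCurve.evalMap_surjective hm Q hQr P hP hPr hPQ, ?_⟩
  ext c
  constructor
  · rintro ⟨h, hh, hreg, rfl⟩
    rw [NonsingularProjectiveCurve.mem_riemannRochSpace_iff hQ] at hh
    exact ⟨⟨h, hh.1⟩, hh.2, rfl⟩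
  · rintro ⟨f, hf, rfl⟩
    exact ⟨f, (NonsingularProjectiveCurve.mem_riemannRochSpace_iff hQ a).mpr ⟨f.2, hf⟩,
      fun i => (P i).mem_localRing_iff.mpr
        (NonsingularProjectiveCurve.mem_regularAway_iff.mp f.2 _
          fun ⟨k, hk⟩ => hPQ i k hk.symm), rfl⟩
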